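/- Let $\mathbb{K}\in\{\mathbb{R},\mathbb{C}\}$ and let $\Gamma=(V,E,a,b,\gamma_0,\gamma_1)$ be a metric graph: $V$ (vertices) and $E$ (edges) are arbitrary sets, not necessarily finite or countable; $a,b\colon E\to[-\infty,\infty]$ satisfy $a_e<b_e$ for all $e\in E$, the edge $e$ corresponding to the interval $(a_e,b_e)\subseteq\mathbb{R}$; with $E_{\mathrm{li}}:=\{e\in E : a_e>-\infty\}$ and $E_{\mathrm{re}}:=\{e\in E : b_e<\infty\}$, the maps $\gamma_0\colon E_{\mathrm{li}}\to V$ and $\gamma_1\colon E_{\mathrm{re}}\to V$ give the starting vertex and the end vertex. Assume that the edge lengths are bounded below, $$\inf_{e\in E}(b_e-a_e)>0 .$$ Let $\mathcal{H}_\Gamma:=\bigoplus_{e\in E}L_2(a_e,b_e)$ (Hilbert space direct sum over $\mathbb{K}$), and let $\hat H$ be the maximal first-derivative operator in $\mathcal{H}_\Gamma$, $$D(\hat H):=\bigoplus_{e\in E}W_2^1(a_e,b_e)=\{f\in\mathcal{H}_\Gamma : \text{the weak derivatives } f_e' \text{ exist and } (f_e')_{e\in E}\in\mathcal{H}_\Gamma\},\qquad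 \hat Hf:=(f_e')_{e\in E}.$$ Define the linear maps $\operatorname{tr}_{\mathrm{li}}\colon D(\hat H)\to\ell_2(E_{\mathrm{li}})$ and $\operatorname{tr}_{\mathrm{re}}\colon D(\hat H)\to\ell_2(E_{\mathrm{re}})$ by $(\operatorname{tr}_{\mathrm{li}}f)(e):=f_e(a_e)$ and $(\operatorname{tr}_{\mathrm{re}}f)(e):=f_e(b_e)$, the end point values of the continuous representative of $f_e$. A linear operator $H$ in $\mathcal{H}_\Gamma$, with domain a linear subspace, is called skew-self-adjoint if its graph $G(H)$ satisfies $$G(H)=\{(y,-x) : (y,x)\in G(H)^*\},\qquad G(H)^*:=\{(y,x)\in\mathcal{H}_\Gamma\oplus\mathcal{H}_\Gamma : \langle y,v\rangle=\langle x,u\rangle \text{ for all } (u,v)\in G(H)\}.$$ Then a linear operator $H\subseteq\hat H$ (a restriction of $\hat H$ to a linear subspace of $D(\hat H)$) is skew-self-adjoint if and only if there exists a unitary operator $L$ from $\ell_2(E_{\mathrm{re}})$ to $\ell_2(E_{\mathrm{li}})$ such that $$D(H)=\{f\in D(\hat H) : L\operatorname{tr}_{\mathrm{re}}f=\operatorname{tr}_{\mathrm{li}}f\}.$$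 -/

import Mathlib

namespace IntervalSobolev

open MeasureTheory Set Filter Topology
open scoped ENNReal ContDiff

variable {𝕜 : Type*} [RCLike 𝕜]

/-- `g` is a weak derivative of `f` on the open set `I ⊆ ℝ`. -/
def HasWeakDeriv (I : Set ℝ) (f g : ℝ → 𝕜) : Prop :=
  ∀ φ : ℝ → ℝ, ContDiff ℝ ∞ φ → HasCompactSupport φ → tsupport φ ⊆ I →
    ∫ x in I, deriv φ x • f x = -∫ x in I, φ x • g x

lemma integrableOn_smul {I : Set ℝ} {f : ℝ → 𝕜}
    (hf : MemLp f 2 (volume.restrict I)) {φ : ℝ → ℝ} (hφ : Continuous φ)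
    (hc : HasCompactSupport φ) : Integrable (fun x => φ x • f x) (volume.restrict I) :=
  (hf.locallyIntegrable (by norm_num)).integrable_smul_left_of_hasCompactSupport hφ hc

lemma exists_Icc {K : Set ℝ} (hK : IsCompact K) : ∃ s t : ℝ, s < t ∧ K ⊆ Ioo s t := by
  obtain ⟨r, hr⟩ := hK.isBounded.subset_ball (0 : ℝ)
  rw [Real.ball_eq_Ioo] at hr
  exact ⟨0 - max r 1, 0 + max r 1, by have := le_max_right r 1; linarith,
    hr.trans (Ioo_subset_Ioo (by have := le_max_left r 1; linarith)
      (by have := le_max_left r 1; linarith))⟩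

/-- Integration by parts for the primitive of a locally integrable function. -/
lemma integral_deriv_smul_primitive {G : ℝ → 𝕜} (hG : LocallyIntegrable G volume) (x₀ : ℝ)
    {φ : ℝ → ℝ} (hφ : ContDiff ℝ ∞ φ) (hc : HasCompactSupport φ) :
    ∫ x, deriv φ x • (∫ y in x₀..x, G y) = -∫ x, φ x • G x := by
  obtain ⟨s, t, hst, hK⟩ := exists_Icc hc
  have hφ1 : ContDiff ℝ 1 φ := hφ.of_le (by exact_mod_cast le_top)
  have hd : Differentiable ℝ φ := hφ1.differentiable (by norm_num)
  have hdc : Continuous (deriv φ) := hφ1.continuous_deriv (by norm_num)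
  have hdcs : HasCompactSupport (deriv φ) := hc.deriv
  have hi : ∀ a b, IntervalIntegrable G volume a b := fun a b =>
    (hG.integrableOn_isCompact isCompact_uIcc).intervalIntegrable
  have hcont : ∀ c, Continuous fun x => ∫ y in c..x, G y :=
    fun c => intervalIntegral.continuous_primitive hi c
  have hφ0 : ∀ x, x ∉ Ioo s t → φ x = 0 := fun x hx =>
    image_eq_zero_of_notMem_tsupport fun h => hx (hK h)
  have hφ0' : ∀ x, x ∉ Ioo s t → deriv φ x = 0 := fun x hx =>
    image_eq_zero_of_notMem_tsupport fun h => hx (hK (tsupport_deriv_subset h))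
  have hφint : ∫ x, deriv φ x = 0 :=
    integral_eq_zero_of_hasDerivAt_of_integrable (fun x => (hd x).hasDerivAt)
      (hdc.integrable_of_hasCompactSupport hdcs) (hφ.continuous.integrable_of_hasCompactSupport hc)
  have hshift : ∫ x, deriv φ x • (∫ y in x₀..x, G y) = ∫ x, deriv φ x • (∫ y in s..x, G y) := by
    have h1 : ∀ x, deriv φ x • (∫ y in x₀..x, G y)
        = deriv φ x • (∫ y in x₀..s, G y) + deriv φ x • (∫ y in s..x, G y) := fun x => by
      rw [← smul_add, intervalIntegral.integral_add_adjacent_intervals (hi _ _) (hi _ _)]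
    simp_rw [h1]
    rw [integral_add, integral_smul_const, hφint, zero_smul, zero_add]
    · exact (hdc.smul continuous_const).integrable_of_hasCompactSupport hdcs.smul_right
    · exact (hdc.smul (hcont s)).integrable_of_hasCompactSupport hdcs.smul_right
  rw [hshift]
  have hGi : IntegrableOn G (Ioc s t) := (hi s t).1
  have hφi : IntegrableOn (deriv φ) (Ioc s t) :=
    (hdc.integrable_of_hasCompactSupport hdcs).integrableOn
  have hset : MeasurableSet {p : ℝ × ℝ | p.2 ≤ p.1} := measurableSet_le measurable_snd measurable_fst
  have hint : Integrable (Function.uncurry fun x y : ℝ =>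
      {p : ℝ × ℝ | p.2 ≤ p.1}.indicator (fun p => deriv φ p.1 • G p.2) (x, y))
      ((volume.restrict (Ioc s t)).prod (volume.restrict (Ioc s t))) :=
    (hφi.smul_prod hGi).indicator hset
  calc ∫ x, deriv φ x • (∫ y in s..x, G y)
      = ∫ x in Ioc s t, deriv φ x • (∫ y in s..x, G y) := by
        refine (setIntegral_eq_integral_of_forall_compl_eq_zero fun x hx => ?_).symm
        rw [hφ0' x fun h => hx (Ioo_subset_Ioc_self h), zero_smul]
    _ = ∫ x in Ioc s t, ∫ y in Ioc s t,
          {p : ℝ × ℝ | p.2 ≤ p.1}.indicator (fun p => deriv φ p.1 • G p.2) (x, y) := by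
        refine setIntegral_congr_fun measurableSet_Ioc fun x hx => ?_
        have : (fun y => {p : ℝ × ℝ | p.2 ≤ p.1}.indicator (fun p => deriv φ p.1 • G p.2) (x, y))
            = (Iic x).indicator fun y => deriv φ x • G y := by
          ext y; simp [indicator]
        simp only [this]
        rw [setIntegral_indicator measurableSet_Iic, integral_smul,
          intervalIntegral.integral_of_le hx.1.le]
        congr 2
        rw [Ioc_inter_Iic, min_eq_right hx.2]
    _ = ∫ y in Ioc s t, ∫ x in Ioc s t,
          {p : ℝ × ℝ | p.2 ≤ p.1}.indicator (fun p => deriv φ p.1 • G p.2) (x, y) :=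
        integral_integral_swap hint
    _ = ∫ y in Ioc s t, -(φ y • G y) := by
        refine setIntegral_congr_fun measurableSet_Ioc fun y hy => ?_
        have : (fun x => {p : ℝ × ℝ | p.2 ≤ p.1}.indicator (fun p => deriv φ p.1 • G p.2) (x, y))
            = (Ici y).indicator fun x => deriv φ x • G y := by
          ext x; simp [indicator]
        simp only [this]
        rw [setIntegral_indicator measurableSet_Ici, integral_smul_const, ← neg_smul]
        congr 1
        have h2 : Ioc s t ∩ Ici y = Icc y t := by
          ext x; simp only [mem_inter_iff, mem_Ioc, mem_Ici, mem_Icc]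
          constructor
          · rintro ⟨⟨_, h⟩, h'⟩; exact ⟨h', h⟩
          · rintro ⟨h, h'⟩; exact ⟨⟨hy.1.trans_le h, h'⟩, h⟩
        rw [h2, integral_Icc_eq_integral_Ioc, ← intervalIntegral.integral_of_le hy.2,
          intervalIntegral.integral_deriv_eq_sub (fun x _ => hd x)
            (hdc.intervalIntegrable _ _), hφ0 t (by simp), zero_sub]
    _ = -∫ x, φ x • G x := by
        rw [integral_neg, setIntegral_eq_integral_of_forall_compl_eq_zero fun x hx => ?_]
        rw [hφ0 x fun h => hx (Ioo_subset_Ioc_self h), zero_smul]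

/-- A function whose weak derivative vanishes on an open interval is a.e. constant there. -/
lemma exists_ae_eq_const {I : Set ℝ} (hI : IsOpen I) (hI' : I.OrdConnected) {h : ℝ → 𝕜}
    (hh : LocallyIntegrable h (volume.restrict I))
    (h0 : ∀ φ : ℝ → ℝ, ContDiff ℝ ∞ φ → HasCompactSupport φ → tsupport φ ⊆ I →
      ∫ x in I, deriv φ x • h x = 0) :
    ∃ c : 𝕜, h =ᵐ[volume.restrict I] fun _ => c := by
  rcases I.eq_empty_or_nonempty with rfl | ⟨x₀, hx₀⟩
  · exact ⟨0, by simp [Filter.EventuallyEq]⟩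
  obtain ⟨r, hr, hrI⟩ := Metric.isOpen_iff.1 hI x₀ hx₀
  let B : ContDiffBump x₀ := ⟨r / 4, r / 2, by positivity, by linarith⟩
  let η : ℝ → ℝ := B.normed volume
  have hη : ContDiff ℝ ∞ η := B.contDiff_normed
  have hηc : HasCompactSupport η := B.hasCompactSupport_normed
  have hηI : tsupport η ⊆ I := by
    rw [B.tsupport_normed_eq]
    exact (Metric.closedBall_subset_ball (show r / 2 < r by linarith)).trans hrI
  have hη1 : ∫ x, η x = 1 := B.integral_normed
  refine ⟨∫ x in I, η x • h x, ?_⟩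
  set c := ∫ x in I, η x • h x with hc
  have hsm : ∀ {φ : ℝ → ℝ}, Continuous φ → HasCompactSupport φ →
      Integrable (fun x => φ x • h x) (volume.restrict I) :=
    fun hφ hφc => hh.integrable_smul_left_of_hasCompactSupport hφ hφc
  have key : ∀ φ : ℝ → ℝ, ContDiff ℝ ∞ φ → HasCompactSupport φ → tsupport φ ⊆ I →
      ∫ x, φ x • (h x - c) = 0 := by
    intro φ hφ hφc hφI
    let ψ : ℝ → ℝ := fun x => φ x - (∫ y, φ y) * η x
    have hψ : ContDiff ℝ ∞ ψ := hφ.sub (contDiff_const.mul hη)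
    have hφi : Integrable φ := hφ.continuous.integrable_of_hasCompactSupport hφc
    have hηi : Integrable η := hη.continuous.integrable_of_hasCompactSupport hηc
    have hψ0 : ∫ x, ψ x = 0 := by
      simp only [ψ]
      rw [integral_sub hφi (hηi.const_mul _), integral_const_mul, hη1, mul_one, sub_self]
    let K := tsupport φ ∪ tsupport η
    have hK : IsCompact K := hφc.union hηc
    have hKI : K ⊆ I := union_subset hφI hηI
    have hKne : K.Nonempty := ⟨x₀, Or.inr (by
      rw [B.tsupport_normed_eq]; exact Metric.mem_closedBall_self (by positivity))⟩
    have hψK : ∀ x, x ∉ K → ψ x = 0 := by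
      intro x hx
      simp only [K, mem_union, not_or] at hx
      simp only [ψ, image_eq_zero_of_notMem_tsupport hx.1, image_eq_zero_of_notMem_tsupport hx.2]
      simp
    let s := sInf K
    let t := sSup K
    have hs : s ∈ K := hK.sInf_mem hKne
    have ht : t ∈ K := hK.sSup_mem hKne
    have hKst : K ⊆ Icc s t := fun x hx =>
      ⟨csInf_le hK.bddBelow hx, le_csSup hK.bddAbove hx⟩
    have hstI : Icc s t ⊆ I := hI'.out (hKI hs) (hKI ht)
    have hst : s ≤ t := (hKst hs).2
    let Φ : ℝ → ℝ := fun x => ∫ y in s..x, ψ y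
    have hΦd : ∀ x, HasDerivAt Φ (ψ x) x := fun x =>
      intervalIntegral.integral_hasDerivAt_right (hψ.continuous.intervalIntegrable _ _)
        (hψ.continuous.stronglyMeasurableAtFilter _ _) hψ.continuous.continuousAt
    have hΦ' : deriv Φ = ψ := funext fun x => (hΦd x).deriv
    have hΦ : ContDiff ℝ ∞ Φ :=
      contDiff_infty_iff_deriv.2 ⟨fun x => (hΦd x).differentiableAt, hΦ'.symm ▸ hψ⟩
    have hΦ0 : ∀ x, x ∉ Icc s t → Φ x = 0 := by
      intro x hx
      rcases lt_or_ge x s with hxs | hxs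
      · simp only [Φ]
        rw [intervalIntegral.integral_symm, intervalIntegral.integral_of_le hxs.le,
          ← integral_Ico_eq_integral_Ioc,
          setIntegral_congr_fun (g := fun _ => (0 : ℝ)) measurableSet_Ico]
        · simp
        · intro y hy
          exact hψK y fun hyK => absurd (hKst hyK).1 (not_le.2 hy.2)
      · have hxt : t < x := lt_of_not_ge fun h => hx ⟨hxs, h⟩
        simp only [Φ]
        rw [intervalIntegral.integral_of_le hxs, ← integral_Icc_eq_integral_Ioc,
          setIntegral_eq_integral_of_forall_compl_eq_zero, hψ0]
        intro y hy
        exact hψK y fun hyK => hy ⟨(hKst hyK).1, (hKst hyK).2.trans hxt.le⟩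
    have hΦs : tsupport Φ ⊆ Icc s t :=
      closure_minimal (fun x hx => by by_contra h; exact hx (hΦ0 x h)) isClosed_Icc
    have hΦc : HasCompactSupport Φ := isCompact_Icc.of_isClosed_subset (isClosed_tsupport _) hΦs
    have := h0 Φ hΦ hΦc (hΦs.trans hstI)
    rw [hΦ'] at this
    have h3 : ∫ x in I, φ x • h x = (∫ y, φ y) • c := by
      have e : ∀ x, ψ x • h x = φ x • h x - (∫ y, φ y) • (η x • h x) := fun x => by
        simp only [ψ, sub_smul, mul_smul]
      simp_rw [e] at this
      rw [integral_sub (hsm hφ.continuous hφc) (by exact (hsm hη.continuous hηc).smul (∫ y, φ y)), integral_smul,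
        sub_eq_zero] at this
      exact this
    have hφ0 : ∀ x, x ∉ I → φ x = 0 := fun x hx =>
      image_eq_zero_of_notMem_tsupport fun h => hx (hφI h)
    rw [← setIntegral_eq_integral_of_forall_compl_eq_zero (s := I)
      (fun x hx => by rw [hφ0 x hx, zero_smul])]
    simp_rw [smul_sub]
    rw [integral_sub (hsm hφ.continuous hφc) (hφi.integrableOn.smul_const c), h3,
      integral_smul_const, setIntegral_eq_integral_of_forall_compl_eq_zero hφ0, sub_self]
  have hloc : LocallyIntegrableOn (fun x => h x - c) I volume := by
    refine LocallyIntegrableOn.sub ?_ ((locallyIntegrable_const c).locallyIntegrableOn I)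
    rw [locallyIntegrableOn_iff hI.isLocallyClosed]
    intro k hk hkc
    have := hh.integrableOn_isCompact hkc
    rwa [IntegrableOn, Measure.restrict_restrict hkc.measurableSet,
      inter_eq_left.2 hk] at this
  have := hI.ae_eq_zero_of_integral_contDiff_smul_eq_zero hloc key
  rw [Filter.EventuallyEq, ae_restrict_iff' hI.measurableSet]
  filter_upwards [this] with x hx hxI
  exact sub_eq_zero.1 (hx hxI)

lemma HasWeakDeriv.ae_unique {I : Set ℝ} (hI : IsOpen I) {f g₁ g₂ : ℝ → 𝕜}
    (hg₁ : MemLp g₁ 2 (volume.restrict I)) (hg₂ : MemLp g₂ 2 (volume.restrict I))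
    (h₁ : HasWeakDeriv I f g₁) (h₂ : HasWeakDeriv I f g₂) : g₁ =ᵐ[volume.restrict I] g₂ := by
  have hloc : LocallyIntegrableOn (fun x => g₁ x - g₂ x) I volume := by
    rw [locallyIntegrableOn_iff hI.isLocallyClosed]
    intro k hk hkc
    have := ((hg₁.sub hg₂).locallyIntegrable (by norm_num)).integrableOn_isCompact hkc
    rwa [IntegrableOn, Measure.restrict_restrict hkc.measurableSet, inter_eq_left.2 hk] at this
  have := hI.ae_eq_zero_of_integral_contDiff_smul_eq_zero hloc fun φ hφ hφc hφI => by
    rw [← setIntegral_eq_integral_of_forall_compl_eq_zero (s := I) (fun x hx => by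
      rw [image_eq_zero_of_notMem_tsupport fun h => hx (hφI h), zero_smul])]
    simp_rw [smul_sub]
    rw [integral_sub (integrableOn_smul hg₁ hφ.continuous hφc)
      (integrableOn_smul hg₂ hφ.continuous hφc), sub_eq_zero, ← neg_inj,
      ← h₁ φ hφ hφc hφI, ← h₂ φ hφ hφc hφI]
  rw [Filter.EventuallyEq, ae_restrict_iff' hI.measurableSet]
  filter_upwards [this] with x hx hxI
  exact sub_eq_zero.1 (hx hxI)

/-- A function in `L²(I)` with weak derivative `g ∈ L²(I)` is a.e. a primitive of `g`. -/
lemma HasWeakDeriv.exists_primitive {I : Set ℝ} (hI : IsOpen I) (hI' : I.OrdConnected)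
    {f g : ℝ → 𝕜} (hf : MemLp f 2 (volume.restrict I)) (hg : MemLp g 2 (volume.restrict I))
    (h : HasWeakDeriv I f g) :
    ∃ F : ℝ → 𝕜, Continuous F ∧ F =ᵐ[volume.restrict I] f ∧
      ∀ x y, F y - F x = ∫ t in x..y, I.indicator g t := by
  have hG : LocallyIntegrable (I.indicator g) volume :=
    ((memLp_indicator_iff_restrict hI.measurableSet).2 hg).locallyIntegrable (by norm_num)
  have hi : ∀ a b, IntervalIntegrable (I.indicator g) volume a b :=
    fun a b =>
    (hG.integrableOn_isCompact isCompact_uIcc).intervalIntegrable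
  let P : ℝ → 𝕜 := fun x => ∫ t in (0 : ℝ)..x, I.indicator g t
  have hP : Continuous P := intervalIntegral.continuous_primitive hi 0
  have hPl : LocallyIntegrable P (volume.restrict I) :=
    hP.locallyIntegrable
  have hfl : LocallyIntegrable f (volume.restrict I) := hf.locallyIntegrable (by norm_num)
  obtain ⟨c, hc⟩ := exists_ae_eq_const hI hI' (hfl.sub hPl) fun φ hφ hφc hφI => by
    have hφ1 : ContDiff ℝ 1 φ := hφ.of_le (by exact_mod_cast le_top)
    have hdc : Continuous (deriv φ) := hφ1.continuous_deriv (by norm_num)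
    simp_rw [Pi.sub_apply, smul_sub]
    rw [integral_sub (hfl.integrable_smul_left_of_hasCompactSupport hdc hφc.deriv)
      (hPl.integrable_smul_left_of_hasCompactSupport hdc hφc.deriv), h φ hφ hφc hφI,
      setIntegral_eq_integral_of_forall_compl_eq_zero (s := I) (f := fun x => deriv φ x • P x)
        (fun x hx => by
          rw [image_eq_zero_of_notMem_tsupport
            fun h => hx (hφI (tsupport_deriv_subset h)), zero_smul]),
      integral_deriv_smul_primitive hG 0 hφ hφc, sub_eq_zero, neg_inj,
      ← integral_indicator hI.measurableSet]
    congr 1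
    ext x
    by_cases hx : x ∈ I <;> simp [hx]
  refine ⟨fun x => c + P x, continuous_const.add hP, ?_, fun x y => ?_⟩
  · filter_upwards [hc] with x hx
    rw [← hx]; simp
  · simp only [P]
    rw [add_sub_add_left_eq_sub, intervalIntegral.integral_interval_sub_left (hi _ _) (hi _ _)]


lemma sq_integral_le {s t : ℝ} (hst : s < t) {u : ℝ → ℝ}
    (hu : MemLp u 2 (volume.restrict (Ioc s t))) :
    (∫ x in Ioc s t, u x) ^ 2 ≤ (t - s) * ∫ x in Ioc s t, u x ^ 2 := by
  have hts : 0 < t - s := sub_pos.2 hst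
  have hv : volume.real (Ioc s t) = t - s := by
    rw [Measure.real, Real.volume_Ioc, ENNReal.toReal_ofReal hts.le]
  have hu1 : Integrable u (volume.restrict (Ioc s t)) := hu.integrable (by norm_num)
  have hu2 : Integrable (fun x => u x ^ 2) (volume.restrict (Ioc s t)) := hu.integrable_sq
  set A := ∫ x in Ioc s t, u x
  have h0 : 0 ≤ ∫ x in Ioc s t, (((t - s) ^ 2 * u x ^ 2 - (2 * A * (t - s)) * u x) + A ^ 2) :=
    integral_nonneg fun x => by
      have : ((t - s) ^ 2 * u x ^ 2 - (2 * A * (t - s)) * u x) + A ^ 2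
        = ((t - s) * u x - A) ^ 2 := by ring
      simp only [this]; positivity
  rw [integral_add (by exact (hu2.const_mul _).sub (hu1.const_mul _)) (integrable_const _),
    integral_sub (hu2.const_mul _) (hu1.const_mul _), integral_const_mul, integral_const_mul,
    setIntegral_const, hv, smul_eq_mul] at h0
  change 0 ≤ (t - s) ^ 2 * _ - 2 * A * (t - s) * A + (t - s) * A ^ 2 at h0
  have : 0 ≤ (t - s) * ((t - s) * (∫ x in Ioc s t, u x ^ 2) - A ^ 2) := by linarith
  have := nonneg_of_mul_nonneg_right this hts
  linarith

/-- The one-dimensional Sobolev inequality for point values. -/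
lemma sq_norm_apply_le {I : Set ℝ} (hI : MeasurableSet I) {F g : ℝ → 𝕜}
    (hF : MemLp F 2 (volume.restrict I)) (hg : MemLp g 2 (volume.restrict I))
    (hFg : ∀ x y, F y - F x = ∫ t in x..y, I.indicator g t)
    {s t p : ℝ} (hst : s < t) (hsub : Ioo s t ⊆ I) (hp : p ∈ Icc s t) :
    (t - s) * ‖F p‖ ^ 2 ≤
      2 * (∫ x in I, ‖F x‖ ^ 2) + 2 * (t - s) ^ 2 * ∫ x in I, ‖g x‖ ^ 2 := by
  have hts : 0 < t - s := sub_pos.2 hst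
  have hv : volume.real (Ioo s t) = t - s := by
    rw [Measure.real, Real.volume_Ioo, ENNReal.toReal_ofReal hts.le]
  have hG : MemLp (I.indicator g) 2 volume := (memLp_indicator_iff_restrict hI).2 hg
  have hGn : MemLp (fun x => ‖I.indicator g x‖) 2 volume := hG.norm
  have hG1 : IntegrableOn (fun x => ‖I.indicator g x‖) (Ioc s t) :=
    (hGn.restrict _).integrable (by norm_num)
  set A := ∫ x in Ioc s t, ‖I.indicator g x‖ with hA
  have hA0 : 0 ≤ A := integral_nonneg fun _ => norm_nonneg _
  have hF2 : IntegrableOn (fun x => ‖F x‖ ^ 2) I := hF.norm.integrable_sq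
  have hA2 : A ^ 2 ≤ (t - s) * ∫ x in I, ‖g x‖ ^ 2 := by
    refine (sq_integral_le hst (hGn.restrict _)).trans ?_
    refine mul_le_mul_of_nonneg_left ?_ hts.le
    refine (setIntegral_le_integral hGn.integrable_sq
      (ae_of_all _ fun x => by positivity)).trans_eq ?_
    rw [← integral_indicator hI]
    congr 1
    ext x
    by_cases hx : x ∈ I <;> simp [hx]
  have hpt : ∀ x ∈ Ioo s t, ‖F p‖ ^ 2 ≤ 2 * ‖F x‖ ^ 2 + 2 * A ^ 2 := by
    intro x hx
    have h1 : ‖F p - F x‖ ≤ A := by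
      rw [hFg x p]
      refine intervalIntegral.norm_integral_le_integral_norm_uIoc.trans ?_
      refine setIntegral_mono_set hG1 (ae_of_all _ fun _ => norm_nonneg _) ?_
      refine LE.le.eventuallyLE ?_
      rw [uIoc]
      exact Ioc_subset_Ioc (le_min hx.1.le hp.1) (max_le hx.2.le hp.2)
    have h2 : ‖F p‖ ≤ ‖F x‖ + A := by
      have := norm_sub_norm_le (F p) (F x)
      linarith
    have h3 : ‖F p‖ ^ 2 ≤ (‖F x‖ + A) ^ 2 := pow_le_pow_left₀ (norm_nonneg _) h2 2
    nlinarith [sq_nonneg (‖F x‖ - A)]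
  have hFo : IntegrableOn (fun x => ‖F x‖ ^ 2) (Ioo s t) := hF2.mono_set hsub
  have hfin : volume (Ioo s t) ≠ ⊤ := by simp
  have h4 : ∫ _ in Ioo s t, ‖F p‖ ^ 2 ≤ ∫ x in Ioo s t, (2 * ‖F x‖ ^ 2 + 2 * A ^ 2) :=
    setIntegral_mono_on (integrableOn_const hfin)
      (Integrable.add (hFo.const_mul 2) (integrableOn_const hfin)) measurableSet_Ioo hpt
  rw [integral_add (hFo.const_mul 2) (integrableOn_const hfin), setIntegral_const,
    setIntegral_const, integral_const_mul, hv, smul_eq_mul, smul_eq_mul] at h4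
  have h5 : ∫ x in Ioo s t, ‖F x‖ ^ 2 ≤ ∫ x in I, ‖F x‖ ^ 2 :=
    setIntegral_mono_set hF2 (ae_of_all _ fun _ => by positivity) hsub.eventuallyLE
  nlinarith [mul_le_mul_of_nonneg_left hA2 hts.le]

lemma norm_sq_eq_integral {μ : Measure ℝ} (f : Lp 𝕜 2 μ) : ‖f‖ ^ 2 = ∫ x, ‖f x‖ ^ 2 ∂μ := by
  rw [← inner_self_eq_norm_sq (𝕜 := 𝕜) f, L2.inner_def, ← integral_re (L2.integrable_inner f f)]
  simp_rw [inner_self_eq_norm_sq]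

lemma HasWeakDeriv.congr_ae {I : Set ℝ} {f f' g g' : ℝ → 𝕜} (h : HasWeakDeriv I f g)
    (hf : f =ᵐ[volume.restrict I] f') (hg : g =ᵐ[volume.restrict I] g') :
    HasWeakDeriv I f' g' := fun φ hφ hc hI => by
  rw [← integral_congr_ae (hf.mono fun x hx => show deriv φ x • f x = deriv φ x • f' x by rw [hx]), h φ hφ hc hI,
    integral_congr_ae (hg.mono fun x hx => show φ x • g x = φ x • g' x by rw [hx])]

lemma HasWeakDeriv.zero {I : Set ℝ} :
    HasWeakDeriv I (0 : Lp 𝕜 2 (volume.restrict I)) (0 : Lp 𝕜 2 (volume.restrict I)) :=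
  HasWeakDeriv.congr_ae (f := 0) (g := 0) (fun φ _ _ _ => by simp)
    (Lp.coeFn_zero _ _ _).symm (Lp.coeFn_zero _ _ _).symm

lemma HasWeakDeriv.add {I : Set ℝ} {f f' g g' : Lp 𝕜 2 (volume.restrict I)}
    (h : HasWeakDeriv I f g) (h' : HasWeakDeriv I f' g') :
    HasWeakDeriv I (f + f' : Lp 𝕜 2 (volume.restrict I)) (g + g' : Lp 𝕜 2 (volume.restrict I)) := by
  refine HasWeakDeriv.congr_ae (f := (f : ℝ → 𝕜) + (f' : ℝ → 𝕜))
    (g := (g : ℝ → 𝕜) + (g' : ℝ → 𝕜)) (fun φ hφ hc hI => ?_)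
    (Lp.coeFn_add f f').symm (Lp.coeFn_add g g').symm
  have hφ1 : ContDiff ℝ 1 φ := hφ.of_le (by exact_mod_cast le_top)
  have hdc : Continuous (deriv φ) := hφ1.continuous_deriv (by norm_num)
  simp_rw [Pi.add_apply, smul_add]
  rw [integral_add (integrableOn_smul (Lp.memLp f) hdc hc.deriv)
      (integrableOn_smul (Lp.memLp f') hdc hc.deriv),
    integral_add (integrableOn_smul (Lp.memLp g) hφ.continuous hc)
      (integrableOn_smul (Lp.memLp g') hφ.continuous hc), h φ hφ hc hI, h' φ hφ hc hI, neg_add]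

lemma HasWeakDeriv.smul {I : Set ℝ} (c : 𝕜) {f g : Lp 𝕜 2 (volume.restrict I)}
    (h : HasWeakDeriv I f g) :
    HasWeakDeriv I (c • f : Lp 𝕜 2 (volume.restrict I)) (c • g : Lp 𝕜 2 (volume.restrict I)) := by
  refine HasWeakDeriv.congr_ae (f := c • (f : ℝ → 𝕜)) (g := c • (g : ℝ → 𝕜)) (fun φ hφ hc hI => ?_)
    (Lp.coeFn_smul c f).symm (Lp.coeFn_smul c g).symm
  simp_rw [Pi.smul_apply, smul_comm _ c]
  rw [integral_smul, integral_smul, h φ hφ hc hI, smul_neg]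

lemma HasWeakDeriv.unique {I : Set ℝ} (hI : IsOpen I) {f g g' : Lp 𝕜 2 (volume.restrict I)}
    (h : HasWeakDeriv I f g) (h' : HasWeakDeriv I f g') : g = g' :=
  Lp.ext (h.ae_unique hI (Lp.memLp g) (Lp.memLp g') h')

open Classical in
/-- The continuous representative of `f`: a function that is continuous on the closure of `I` and
agrees with `f` almost everywhere on `I` (and `0` if there is none). For open `I` its values on the
closure of `I` are uniquely determined. -/
noncomputable def contRep (I : Set ℝ) (f : ℝ → 𝕜) : ℝ → 𝕜 :=
  if h : ∃ F : ℝ → 𝕜, ContinuousOn F (closure I) ∧ F =ᵐ[volume.restrict I] f then h.choose else 0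

lemma contRep_eq {I : Set ℝ} (hI : IsOpen I) {f F : ℝ → 𝕜} (hF : ContinuousOn F (closure I))
    (hFf : F =ᵐ[volume.restrict I] f) : EqOn (contRep I f) F (closure I) := by
  have h : ∃ F : ℝ → 𝕜, ContinuousOn F (closure I) ∧ F =ᵐ[volume.restrict I] f := ⟨F, hF, hFf⟩
  rw [contRep, dif_pos h]
  obtain ⟨h1, h2⟩ := h.choose_spec
  exact (Measure.eqOn_open_of_ae_eq (h2.trans hFf.symm) hI (h1.mono subset_closure)
    (hF.mono subset_closure)).of_subset_closure h1 hF subset_closure subset_rfl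

end IntervalSobolev

/-- A metric graph: `V` is the set of vertices, `E` the set of edges, the edge `e` corresponds to
the interval `(a e, b e) ⊆ ℝ`, every finite left end point has a starting vertex and every finite
right end point has an end vertex. -/
structure MetricGraph (V E : Type*) where
  a : E → EReal
  b : E → EReal
  a_lt_b : ∀ e, a e < b e
  startVertex : {e : E // ⊥ < a e} → V
  endVertex : {e : E // b e < ⊤} → V

namespace MetricGraph

open IntervalSobolev
open MeasureTheory Set Filter Topology
open scoped ENNReal ContDiff

variable {V E : Type*} (Γ : MetricGraph V E) (𝕜 : Type*) [RCLike 𝕜]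

/-- The edges with a finite left end point. -/
def leftEdges : Set E := {e | ⊥ < Γ.a e}

/-- The edges with a finite right end point. -/
def rightEdges : Set E := {e | Γ.b e < ⊤}

/-- The open interval `(a e, b e)`. -/
def interval (e : E) : Set ℝ := {x | Γ.a e < x ∧ (x : EReal) < Γ.b e}

lemma isOpen_interval (e : E) : IsOpen (Γ.interval e) :=
  (isOpen_lt continuous_const continuous_coe_real_ereal).inter
    (isOpen_lt continuous_coe_real_ereal continuous_const)

lemma ordConnected_interval (e : E) : (Γ.interval e).OrdConnected :=
  ⟨fun _ hx _ hy _ hz => ⟨hx.1.trans_le (EReal.coe_le_coe_iff.2 hz.1),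
    (EReal.coe_le_coe_iff.2 hz.2).trans_lt hy.2⟩⟩

/-- The Hilbert space `⨁_{e ∈ E} L²(a e, b e)`. -/
noncomputable abbrev L2Space := lp (fun e : E => Lp 𝕜 2 (volume.restrict (Γ.interval e))) 2

variable {Γ 𝕜} in
/-- `g` is the edgewise weak derivative of `f`. -/
def IsDeriv (f g : Γ.L2Space 𝕜) : Prop := ∀ e, HasWeakDeriv (Γ.interval e) (f e) (g e)

variable {Γ 𝕜} in
lemma IsDeriv.add {f f' g g' : Γ.L2Space 𝕜} (h : IsDeriv f g) (h' : IsDeriv f' g') :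
    IsDeriv (f + f') (g + g') := fun e => (h e).add (h' e)

variable {Γ 𝕜} in
lemma IsDeriv.smul (c : 𝕜) {f g : Γ.L2Space 𝕜} (h : IsDeriv f g) :
    IsDeriv (c • f) (c • g) := fun e => (h e).smul c

variable {Γ 𝕜} in
lemma IsDeriv.unique {f g g' : Γ.L2Space 𝕜} (h : IsDeriv f g) (h' : IsDeriv f g') : g = g' :=
  lp.ext (funext fun e => (h e).unique (Γ.isOpen_interval e) (h' e))

/-- The maximal first derivative operator: its domain is `⨁_{e ∈ E} W₂¹(a e, b e)`, i.e. all
`f ∈ ⨁_e L²(a e, b e)` for which the edgewise weak derivatives exist and form an element of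
`⨁_e L²(a e, b e)`, and it maps `f` to `(f_e')_e`. -/
noncomputable def maxDeriv : Γ.L2Space 𝕜 →ₗ.[𝕜] Γ.L2Space 𝕜 where
  domain :=
    { carrier := {f | ∃ g : Γ.L2Space 𝕜, IsDeriv f g}
      zero_mem' := ⟨0, fun _ => HasWeakDeriv.zero⟩
      add_mem' := fun ⟨g, hg⟩ ⟨g', hg'⟩ => ⟨g + g', hg.add hg'⟩
      smul_mem' := fun c _ ⟨g, hg⟩ => ⟨c • g, hg.smul c⟩ }
  toFun :=
    { toFun := fun f => f.2.choose
      map_add' := fun f f' =>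
        (f + f').2.choose_spec.unique (f.2.choose_spec.add f'.2.choose_spec)
      map_smul' := fun c f => (c • f).2.choose_spec.unique (f.2.choose_spec.smul c) }

lemma maxDeriv_spec (f : (Γ.maxDeriv 𝕜).domain) : IsDeriv (f : Γ.L2Space 𝕜) (Γ.maxDeriv 𝕜 f) :=
  f.2.choose_spec

variable {Γ 𝕜}

lemma exists_rep (f : (Γ.maxDeriv 𝕜).domain) (e : E) :
    ∃ F : ℝ → 𝕜, Continuous F ∧ F =ᵐ[volume.restrict (Γ.interval e)] (f : Γ.L2Space 𝕜) e ∧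
      (∀ x y, F y - F x = ∫ t in x..y, (Γ.interval e).indicator (Γ.maxDeriv 𝕜 f e) t) ∧
      EqOn (contRep (Γ.interval e) ((f : Γ.L2Space 𝕜) e)) F (closure (Γ.interval e)) := by
  obtain ⟨F, h1, h2, h3⟩ := (Γ.maxDeriv_spec 𝕜 f e).exists_primitive (Γ.isOpen_interval e)
    (Γ.ordConnected_interval e) (Lp.memLp _) (Lp.memLp _)
  exact ⟨F, h1, h2, h3, contRep_eq (Γ.isOpen_interval e) h1.continuousOn h2⟩

lemma contRep_add (f f' : (Γ.maxDeriv 𝕜).domain) (e : E) {p : ℝ}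
    (hp : p ∈ closure (Γ.interval e)) :
    contRep (Γ.interval e) (((f + f' : (Γ.maxDeriv 𝕜).domain) : Γ.L2Space 𝕜) e) p =
      contRep (Γ.interval e) ((f : Γ.L2Space 𝕜) e) p +
        contRep (Γ.interval e) ((f' : Γ.L2Space 𝕜) e) p := by
  obtain ⟨F, h1, h2, -, h4⟩ := exists_rep f e
  obtain ⟨F', h1', h2', -, h4'⟩ := exists_rep f' e
  rw [h4 hp, h4' hp]
  refine contRep_eq (F := F + F') (Γ.isOpen_interval e) (h1.add h1').continuousOn ?_ hp
  exact (h2.add h2').trans (Lp.coeFn_add _ _).symm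

lemma contRep_smul (c : 𝕜) (f : (Γ.maxDeriv 𝕜).domain) (e : E) {p : ℝ}
    (hp : p ∈ closure (Γ.interval e)) :
    contRep (Γ.interval e) (((c • f : (Γ.maxDeriv 𝕜).domain) : Γ.L2Space 𝕜) e) p =
      c • contRep (Γ.interval e) ((f : Γ.L2Space 𝕜) e) p := by
  obtain ⟨F, h1, h2, -, h4⟩ := exists_rep f e
  rw [h4 hp]
  refine contRep_eq (F := c • F) (Γ.isOpen_interval e) (h1.const_smul c).continuousOn ?_ hp
  exact (h2.const_smul c).trans (Lp.coeFn_smul _ _).symm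

lemma sq_norm_contRep_le {l : ℝ} (hl : 0 < l) (f : (Γ.maxDeriv 𝕜).domain) (e : E) {s p : ℝ}
    (hs : Ioo s (s + l) ⊆ Γ.interval e) (hp : p ∈ Icc s (s + l)) :
    ‖contRep (Γ.interval e) ((f : Γ.L2Space 𝕜) e) p‖ ^ 2 ≤
      (2 / l) * ‖(f : Γ.L2Space 𝕜) e‖ ^ 2 + (2 * l) * ‖Γ.maxDeriv 𝕜 f e‖ ^ 2 := by
  obtain ⟨F, h1, h2, h3, h4⟩ := exists_rep f e
  have hcl : p ∈ closure (Γ.interval e) := by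
    refine closure_mono hs ?_
    rwa [closure_Ioo (by linarith)]
  have h := sq_norm_apply_le (Γ.isOpen_interval e).measurableSet
    ((memLp_congr_ae h2).2 (Lp.memLp _)) (Lp.memLp _) h3 (by linarith) hs hp
  rw [integral_congr_ae (g := fun x => ‖(f : Γ.L2Space 𝕜) e x‖ ^ 2)
    (h2.mono fun x hx => by simp only [hx]), ← norm_sq_eq_integral, ← norm_sq_eq_integral,
    add_sub_cancel_left] at h
  rw [h4 hcl]
  have : (2 / l) * ‖(f : Γ.L2Space 𝕜) e‖ ^ 2 + (2 * l) * ‖Γ.maxDeriv 𝕜 f e‖ ^ 2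
      = (2 * ‖(f : Γ.L2Space 𝕜) e‖ ^ 2 + 2 * l ^ 2 * ‖Γ.maxDeriv 𝕜 f e‖ ^ 2) / l := by
    field_simp
  rw [this, le_div_iff₀ hl]
  linarith

lemma memℓp_contRep {S : Set E} {p : S → ℝ} {l : ℝ} (hl : 0 < l)
    (hp : ∀ e : S, ∃ s, Ioo s (s + l) ⊆ Γ.interval e ∧ p e ∈ Icc s (s + l))
    (f : (Γ.maxDeriv 𝕜).domain) :
    Memℓp (fun e : S => contRep (Γ.interval e) ((f : Γ.L2Space 𝕜) e) (p e)) 2 := by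
  have key : ∀ u : Γ.L2Space 𝕜, Summable fun e : S => ‖u e‖ ^ 2 := fun u => by
    have := (lp.memℓp u).summable (by norm_num)
    simp only [ENNReal.toReal_ofNat, Real.rpow_ofNat] at this
    exact this.comp_injective Subtype.val_injective
  refine memℓp_gen ?_
  simp only [ENNReal.toReal_ofNat, Real.rpow_ofNat]
  refine Summable.of_nonneg_of_le (fun _ => by positivity) (fun e => ?_)
    (((key f).mul_left (2 / l)).add ((key (Γ.maxDeriv 𝕜 f)).mul_left (2 * l)))
  obtain ⟨s, hs, hps⟩ := hp e
  exact sq_norm_contRep_le hl f e hs hps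

lemma exists_length (hΓ : 0 < ⨅ e, (Γ.b e - Γ.a e)) :
    ∃ l : ℝ, 0 < l ∧ ∀ e, (l : EReal) ≤ Γ.b e - Γ.a e := by
  obtain ⟨l, h0, h1⟩ := EReal.lt_iff_exists_real_btwn.1 hΓ
  exact ⟨l, by exact_mod_cast h0, fun e => h1.le.trans (iInf_le _ e)⟩

lemma exists_left {l : ℝ} (hl : 0 < l) (h : ∀ e, (l : EReal) ≤ Γ.b e - Γ.a e)
    (e : Γ.leftEdges) :
    ∃ s, Ioo s (s + l) ⊆ Γ.interval e ∧ (Γ.a e).toReal ∈ Icc s (s + l) := by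
  refine ⟨(Γ.a e).toReal, fun x hx => ?_, le_rfl, by linarith⟩
  have ha : ⊥ < Γ.a e := e.2
  have hab := Γ.a_lt_b e
  have hle := h e
  simp only [interval, mem_ofPred_eq]
  generalize Γ.a e = α at *
  generalize Γ.b e = β at *
  induction α with
  | bot => exact absurd ha (lt_irrefl _)
  | top => exact absurd hab not_top_lt
  | coe α =>
    rw [EReal.toReal_coe] at hx
    refine ⟨EReal.coe_lt_coe_iff.2 hx.1, ?_⟩
    induction β with
    | bot => exact absurd hab not_lt_bot
    | top => exact EReal.coe_lt_top x
    | coe β =>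
      rw [← EReal.coe_sub, EReal.coe_le_coe_iff] at hle
      exact EReal.coe_lt_coe_iff.2 (by linarith [hx.2])

lemma exists_right {l : ℝ} (hl : 0 < l) (h : ∀ e, (l : EReal) ≤ Γ.b e - Γ.a e)
    (e : Γ.rightEdges) :
    ∃ s, Ioo s (s + l) ⊆ Γ.interval e ∧ (Γ.b e).toReal ∈ Icc s (s + l) := by
  refine ⟨(Γ.b e).toReal - l, fun x hx => ?_, by linarith, by linarith⟩
  have hb : Γ.b e < ⊤ := e.2
  have hab := Γ.a_lt_b e
  have hle := h e
  simp only [interval, mem_ofPred_eq]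
  generalize Γ.a e = α at *
  generalize Γ.b e = β at *
  induction β with
  | bot => exact absurd hab not_lt_bot
  | top => exact absurd hb (lt_irrefl _)
  | coe β =>
    rw [EReal.toReal_coe] at hx
    refine ⟨?_, EReal.coe_lt_coe_iff.2 (by linarith [hx.2])⟩
    induction α with
    | bot => exact EReal.bot_lt_coe x
    | top => exact absurd hab not_top_lt
    | coe α =>
      rw [← EReal.coe_sub, EReal.coe_le_coe_iff] at hle
      exact EReal.coe_lt_coe_iff.2 (by linarith [hx.1])

lemma mem_closure {l : ℝ} (hl : 0 < l) {e : E} {p : ℝ}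
    (hp : ∃ s, Ioo s (s + l) ⊆ Γ.interval e ∧ p ∈ Icc s (s + l)) :
    p ∈ closure (Γ.interval e) := by
  obtain ⟨s, hs, hp⟩ := hp
  refine closure_mono hs ?_
  rwa [closure_Ioo (by linarith)]

variable (Γ 𝕜)

/-- The trace `f ↦ (f_e(a e))_e` from `⨁_e W₂¹(a e, b e)` to `ℓ²`, at the finite left end points. -/
noncomputable def leftTrace (hΓ : 0 < ⨅ e, (Γ.b e - Γ.a e)) :
    (Γ.maxDeriv 𝕜).domain →ₗ[𝕜] lp (fun _ : Γ.leftEdges => 𝕜) 2 where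
  toFun f := ⟨fun e => contRep (Γ.interval e) ((f : Γ.L2Space 𝕜) e) (Γ.a e).toReal, by
    obtain ⟨l, hl, h⟩ := exists_length hΓ
    exact memℓp_contRep hl (exists_left hl h) f⟩
  map_add' f f' := by
    obtain ⟨l, hl, h⟩ := exists_length hΓ
    exact lp.ext (funext fun e => contRep_add f f' e (mem_closure hl (exists_left hl h e)))
  map_smul' c f := by
    obtain ⟨l, hl, h⟩ := exists_length hΓ
    exact lp.ext (funext fun e => contRep_smul c f e (mem_closure hl (exists_left hl h e)))

/-- The trace `f ↦ (f_e(b e))_e` from `⨁_e W₂¹(a e, b e)` to `ℓ²`, at the finite right end points. -/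
noncomputable def rightTrace (hΓ : 0 < ⨅ e, (Γ.b e - Γ.a e)) :
    (Γ.maxDeriv 𝕜).domain →ₗ[𝕜] lp (fun _ : Γ.rightEdges => 𝕜) 2 where
  toFun f := ⟨fun e => contRep (Γ.interval e) ((f : Γ.L2Space 𝕜) e) (Γ.b e).toReal, by
    obtain ⟨l, hl, h⟩ := exists_length hΓ
    exact memℓp_contRep hl (exists_right hl h) f⟩
  map_add' f f' := by
    obtain ⟨l, hl, h⟩ := exists_length hΓ
    exact lp.ext (funext fun e => contRep_add f f' e (mem_closure hl (exists_right hl h e)))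
  map_smul' c f := by
    obtain ⟨l, hl, h⟩ := exists_length hΓ
    exact lp.ext (funext fun e => contRep_smul c f e (mem_closure hl (exists_right hl h e)))

end MetricGraph

/-- A linear relation `M ⊆ X ⊕ X` is skew-self-adjoint if `M = S M*`, where `S (x, y) = (x, -y)`
and `M*` is the adjoint relation. -/
def Submodule.IsSkewSelfAdjoint {𝕜 X : Type*} [RCLike 𝕜] [NormedAddCommGroup X]
    [InnerProductSpace 𝕜 X] (M : Submodule 𝕜 (X × X)) : Prop :=
  M = M.adjoint.map (LinearMap.prodMap LinearMap.id (-LinearMap.id))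

/-- A linear operator is skew-self-adjoint if its graph is. -/
def LinearPMap.IsSkewSelfAdjoint {𝕜 X : Type*} [RCLike 𝕜] [NormedAddCommGroup X]
    [InnerProductSpace 𝕜 X] (H : X →ₗ.[𝕜] X) : Prop :=
  H.graph.IsSkewSelfAdjoint

/-!
Integrating by parts on every edge gives Green's formula
`⟪Ĥ f, g⟫ + ⟪f, Ĥ g⟫ = ⟪tr_re f, tr_re g⟫ - ⟪tr_li f, tr_li g⟫`. Testing with functions supported
inside a single edge shows that an element of the adjoint of the restriction of `Ĥ` to the kernel of
both traces is weakly differentiable, so that a skew-self-adjoint operator is determined by its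
boundary values. Since the edge lengths are bounded below, cutoff functions of a fixed width realize
every pair of `ℓ²` boundary values. Hence a restriction of `Ĥ` is skew-self-adjoint if and only if
its domain is the preimage of a subspace of `ℓ²(E_re) × ℓ²(E_li)` that is Lagrangian for the
indefinite form on the right-hand side. Both projections of a Lagrangian subspace are isometric and
have closed range with trivial orthogonal complement, so it is the graph of a unitary operator.
-/

/-! ### Lagrangian subspaces and unitary operators -/

section Lagrangian

variable {𝕜 X Y : Type*} [RCLike 𝕜] [NormedAddCommGroup X] [InnerProductSpace 𝕜 X]
  [NormedAddCommGroup Y] [InnerProductSpace 𝕜 Y]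

theorem linearIsometry_surjective_of_forall_inner_eq_zero {M : Type*} [NormedAddCommGroup M]
    [NormedSpace 𝕜 M] [CompleteSpace M] (P : M →ₗᵢ[𝕜] X)
    (hP : ∀ x, (∀ m, inner 𝕜 (P m) x = 0) → x = 0) : Function.Surjective P := by
  have : CompleteSpace (LinearMap.range P.toLinearMap) :=
    P.isometry.isUniformInducing.isComplete_range.completeSpace_coe
  rw [← LinearIsometry.coe_toLinearMap, ← LinearMap.range_eq_top,
    ← Submodule.orthogonal_eq_bot_iff, Submodule.eq_bot_iff]
  exact fun x hx => hP x fun m => (Submodule.mem_orthogonal _ _).1 hx _ ⟨m, rfl⟩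

/-- A Lagrangian subspace of `X × Y`, i.e. one that equals its own orthogonal complement with
respect to the indefinite form `⟪x, x'⟫ - ⟪y, y'⟫`. -/
def IsLagrangian (M : Submodule 𝕜 (X × Y)) : Prop :=
  ∀ p, p ∈ M ↔ ∀ q ∈ M, inner 𝕜 q.1 p.1 = inner 𝕜 q.2 p.2

namespace IsLagrangian

variable {M : Submodule 𝕜 (X × Y)}

theorem norm_fst_eq_norm_snd (hM : IsLagrangian M) {p : X × Y} (hp : p ∈ M) :
    ‖p.1‖ = ‖p.2‖ := by
  have h := (hM p).1 hp p hp
  rw [inner_self_eq_norm_sq_to_K, inner_self_eq_norm_sq_to_K] at h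
  exact (sq_eq_sq₀ (norm_nonneg _) (norm_nonneg _)).1 (by exact_mod_cast h)

theorem isClosed (hM : IsLagrangian M) : IsClosed (M : Set (X × Y)) := by
  have hM_eq : (M : Set (X × Y)) =
      ⋂ q ∈ M, {p : X × Y | inner 𝕜 q.1 p.1 = inner 𝕜 q.2 p.2} := by
    ext p
    simp only [SetLike.mem_coe, hM p, Set.mem_iInter, Set.mem_ofPred_eq]
  rw [hM_eq]
  exact isClosed_biInter fun q _ => isClosed_eq (by fun_prop) (by fun_prop)

/-- The projection of a Lagrangian subspace to the first component. It is isometric with respect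
to the maximum norm of `X × Y`. -/
def fstIsometry (hM : IsLagrangian M) : M →ₗᵢ[𝕜] X where
  toLinearMap := (LinearMap.fst 𝕜 X Y).comp M.subtype
  norm_map' m := (max_eq_left (hM.norm_fst_eq_norm_snd m.2).ge).symm

/-- The projection of a Lagrangian subspace to the second component. It is isometric with respect
to the maximum norm of `X × Y`. -/
def sndIsometry (hM : IsLagrangian M) : M →ₗᵢ[𝕜] Y where
  toLinearMap := (LinearMap.snd 𝕜 X Y).comp M.subtype
  norm_map' m := (max_eq_right (hM.norm_fst_eq_norm_snd m.2).le).symm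

variable [CompleteSpace X] [CompleteSpace Y]

theorem fstIsometry_surjective (hM : IsLagrangian M) : Function.Surjective hM.fstIsometry := by
  have : CompleteSpace M := hM.isClosed.completeSpace_coe
  refine linearIsometry_surjective_of_forall_inner_eq_zero _ fun x hx => ?_
  have hx_mem : (x, (0 : Y)) ∈ M :=
    (hM _).2 fun q hq => (hx ⟨q, hq⟩).trans (inner_zero_right _).symm
  simpa using hM.norm_fst_eq_norm_snd hx_mem

theorem sndIsometry_surjective (hM : IsLagrangian M) : Function.Surjective hM.sndIsometry := by
  have : CompleteSpace M := hM.isClosed.completeSpace_coe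
  refine linearIsometry_surjective_of_forall_inner_eq_zero _ fun y hy => ?_
  have hy_mem : ((0 : X), y) ∈ M :=
    (hM _).2 fun q hq => (inner_zero_right _).trans (hy ⟨q, hq⟩).symm
  simpa using (hM.norm_fst_eq_norm_snd hy_mem).symm

theorem exists_eq_graph (hM : IsLagrangian M) :
    ∃ L : X ≃ₗᵢ[𝕜] Y, M = LinearMap.graph L.toLinearEquiv.toLinearMap := by
  let P := LinearIsometryEquiv.ofSurjective _ hM.fstIsometry_surjective
  let Q := LinearIsometryEquiv.ofSurjective _ hM.sndIsometry_surjective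
  refine ⟨P.symm.trans Q, Submodule.ext fun p => ⟨fun hp => ?_, fun hp => ?_⟩⟩
  · exact (congrArg Q (P.symm_apply_apply ⟨p, hp⟩)).symm
  · have hp_eq : p = (P.symm p.1 : M) := Prod.ext (P.apply_symm_apply p.1).symm hp
    exact hp_eq ▸ (P.symm p.1).2

end IsLagrangian

theorem isLagrangian_graph (L : X ≃ₗᵢ[𝕜] Y) :
    IsLagrangian (LinearMap.graph L.toLinearEquiv.toLinearMap) := by
  rintro ⟨x, y⟩
  constructor
  · rintro (rfl : y = L x) ⟨x', y'⟩ (rfl : y' = L x')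
    exact (L.inner_map_map x' x).symm
  · intro h
    refine ext_inner_left 𝕜 fun z => ?_
    have hz : inner 𝕜 (L.symm z) x = inner 𝕜 z y := h (L.symm z, z) (L.apply_symm_apply z).symm
    exact hz.symm.trans (L.symm.inner_map_eq_flip z x)

theorem exists_isLagrangian_eq_comap_iff {V : Type*} [AddCommGroup V] [Module 𝕜 V]
    {B : V →ₗ[𝕜] X × Y} (hB : Function.Surjective B) {D : Submodule 𝕜 V} :
    (∃ M, IsLagrangian M ∧ D = M.comap B) ↔
      ∀ f, f ∈ D ↔ ∀ g ∈ D, inner 𝕜 (B g).1 (B f).1 = inner 𝕜 (B g).2 (B f).2 := by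
  constructor
  · rintro ⟨M, hM, rfl⟩ f
    refine (hM (B f)).trans ⟨fun h g hg => h _ hg, fun h q hq => ?_⟩
    obtain ⟨g, rfl⟩ := hB q
    exact h g hq
  · intro hD
    have hker : B.ker ≤ D := fun f hf => (hD f).2 fun g _ => by simp [LinearMap.mem_ker.1 hf]
    have hD_eq : D = (D.map B).comap B := by rw [Submodule.comap_map_eq, sup_eq_left.2 hker]
    refine ⟨D.map B, fun p => ?_, hD_eq⟩
    obtain ⟨f, rfl⟩ := hB p
    rw [← Submodule.mem_comap, ← hD_eq, hD f]
    simp [Submodule.mem_map]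

end Lagrangian

/-! ### Skew-self-adjoint restrictions -/

theorem submodule_isSkewSelfAdjoint_iff {𝕜 X : Type*} [RCLike 𝕜] [NormedAddCommGroup X]
    [InnerProductSpace 𝕜 X] {M : Submodule 𝕜 (X × X)} :
    M.IsSkewSelfAdjoint ↔
      ∀ p, p ∈ M ↔ ∀ q ∈ M, inner 𝕜 q.2 p.1 + inner 𝕜 q.1 p.2 = 0 := by
  have h (p : X × X) : p ∈ M.adjoint.map (LinearMap.prodMap LinearMap.id (-LinearMap.id)) ↔
      ∀ q ∈ M, inner 𝕜 q.2 p.1 + inner 𝕜 q.1 p.2 = 0 := by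
    rw [Submodule.mem_map]
    constructor
    · rintro ⟨q, hq, rfl⟩ ⟨u, v⟩ huv
      simpa [sub_eq_add_neg] using (Submodule.mem_adjoint_iff _ _).1 hq u v huv
    · refine fun hp => ⟨(p.1, -p.2), (Submodule.mem_adjoint_iff _ _).2 fun u v huv => ?_, by simp⟩
      simpa using hp (u, v) huv
  rw [Submodule.IsSkewSelfAdjoint, SetLike.ext_iff]
  simp_rw [h]

theorem linearPMap_isSkewSelfAdjoint_iff {𝕜 X : Type*} [RCLike 𝕜] [NormedAddCommGroup X]
    [InnerProductSpace 𝕜 X] {H : X →ₗ.[𝕜] X} :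
    H.IsSkewSelfAdjoint ↔ ∀ p, p ∈ H.graph ↔
      ∀ u : H.domain, inner 𝕜 (H u) p.1 + inner 𝕜 (u : X) p.2 = 0 := by
  have h (p : X × X) : (∀ q ∈ H.graph, inner 𝕜 q.2 p.1 + inner 𝕜 q.1 p.2 = 0) ↔
      ∀ u : H.domain, inner 𝕜 (H u) p.1 + inner 𝕜 (u : X) p.2 = 0 := by
    refine ⟨fun hp u => hp _ (H.mem_graph u), ?_⟩
    rintro hp ⟨u, v⟩ huv
    obtain ⟨u, rfl, rfl⟩ := H.mem_graph_iff.1 huv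
    exact hp u
  simp_rw [LinearPMap.IsSkewSelfAdjoint, submodule_isSkewSelfAdjoint_iff, h]

section BoundarySystem

variable {𝕜 X Y Z : Type*} [RCLike 𝕜] [NormedAddCommGroup X] [InnerProductSpace 𝕜 X]
  [NormedAddCommGroup Y] [InnerProductSpace 𝕜 Y] [NormedAddCommGroup Z] [InnerProductSpace 𝕜 Z]

/-- A boundary system for the operator `A`: boundary values in `Y × Z` which are surjective,
satisfy Green's formula and are such that the restriction of `A` to the elements without boundary
values has a negative adjoint contained in `A`. -/
structure IsBoundarySystem (A : X →ₗ.[𝕜] X) (B : A.domain →ₗ[𝕜] Y × Z) : Prop where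
  surjective : Function.Surjective B
  inner_add_inner_eq_sub : ∀ f g : A.domain, inner 𝕜 (A f) (g : X) + inner 𝕜 (f : X) (A g) =
    inner 𝕜 (B f).1 (B g).1 - inner 𝕜 (B f).2 (B g).2
  mem_graph_of_forall_inner : ∀ y x : X,
    (∀ u, B u = 0 → inner 𝕜 (A u) y + inner 𝕜 (u : X) x = 0) → (y, x) ∈ A.graph

namespace IsBoundarySystem

variable {A : X →ₗ.[𝕜] X} {B : A.domain →ₗ[𝕜] Y × Z} {H : X →ₗ.[𝕜] X}

theorem isSkewSelfAdjoint_iff_forall_mem_domain (hB : IsBoundarySystem A B) (hH : H ≤ A) :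
    H.IsSkewSelfAdjoint ↔ ∀ f : A.domain, (f : X) ∈ H.domain ↔ ∀ g : A.domain,
      (g : X) ∈ H.domain → inner 𝕜 (B g).1 (B f).1 = inner 𝕜 (B g).2 (B f).2 := by
  have hH_apply (g : A.domain) (hg : (g : X) ∈ H.domain) : H ⟨g, hg⟩ = A g := hH.2 rfl
  have hgraph (f : A.domain) : ((f : X), A f) ∈ H.graph ↔ (f : X) ∈ H.domain :=
    ⟨H.mem_domain_of_mem_graph, fun hf => H.mem_graph_iff.2 ⟨⟨f, hf⟩, rfl, hH_apply f hf⟩⟩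
  have hgreen (f : A.domain) :
      (∀ u : H.domain, inner 𝕜 (H u) (f : X) + inner 𝕜 (u : X) (A f) = 0) ↔
        ∀ g : A.domain, (g : X) ∈ H.domain →
          inner 𝕜 (B g).1 (B f).1 = inner 𝕜 (B g).2 (B f).2 := by
    simp_rw [← sub_eq_zero (b := inner 𝕜 (B _).2 _), ← hB.inner_add_inner_eq_sub]
    exact ⟨fun h g hg => hH_apply g hg ▸ h ⟨g, hg⟩,
      fun h u => hH_apply ⟨u, hH.1 u.2⟩ u.2 ▸ h ⟨u, hH.1 u.2⟩ u.2⟩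
  rw [linearPMap_isSkewSelfAdjoint_iff]
  constructor
  · exact fun hs f => (hgraph f).symm.trans ((hs _).trans (hgreen f))
  · intro hD p
    have hA : p ∈ A.graph → (p ∈ H.graph ↔
        ∀ u : H.domain, inner 𝕜 (H u) p.1 + inner 𝕜 (u : X) p.2 = 0) := by
      obtain ⟨y, x⟩ := p
      intro hp
      obtain ⟨f, rfl, rfl⟩ := A.mem_graph_iff.1 hp
      exact (hgraph f).trans ((hD f).trans (hgreen f).symm)
    refine ⟨fun hp => (hA (LinearPMap.le_graph_of_le hH hp)).1 hp, fun hp => (hA ?_).2 hp⟩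
    refine hB.mem_graph_of_forall_inner p.1 p.2 fun u hu => ?_
    have hu_mem : (u : X) ∈ H.domain := (hD u).2 fun g _ => by simp [hu]
    exact hH_apply u hu_mem ▸ hp ⟨u, hu_mem⟩

theorem isSkewSelfAdjoint_iff_exists_linearIsometryEquiv [CompleteSpace Y] [CompleteSpace Z]
    (hB : IsBoundarySystem A B) (hH : H ≤ A) :
    H.IsSkewSelfAdjoint ↔ ∃ L : Y ≃ₗᵢ[𝕜] Z,
      (H.domain : Set X) = {f | ∃ hf : f ∈ A.domain, L (B ⟨f, hf⟩).1 = (B ⟨f, hf⟩).2} := by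
  have hM := exists_isLagrangian_eq_comap_iff hB.surjective (D := H.domain.comap A.domain.subtype)
  simp only [Submodule.mem_comap, Submodule.subtype_apply] at hM
  rw [hB.isSkewSelfAdjoint_iff_forall_mem_domain hH, ← hM]
  have hdom (L : Y ≃ₗᵢ[𝕜] Z) : H.domain.comap A.domain.subtype =
      (LinearMap.graph L.toLinearEquiv.toLinearMap).comap B ↔
      (H.domain : Set X) = {f | ∃ hf : f ∈ A.domain, L (B ⟨f, hf⟩).1 = (B ⟨f, hf⟩).2} := by
    rw [SetLike.ext_iff, Set.ext_iff]
    constructor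
    · exact fun h f => ⟨fun hf => ⟨hH.1 hf, ((h ⟨f, hH.1 hf⟩).1 hf).symm⟩,
        fun ⟨hf, hLf⟩ => (h ⟨f, hf⟩).2 hLf.symm⟩
    · exact fun h f => (h f).trans ⟨fun ⟨_, hLf⟩ => hLf.symm, fun hLf => ⟨f.2, Eq.symm hLf⟩⟩
  constructor
  · rintro ⟨M, hM, hD⟩
    obtain ⟨L, rfl⟩ := hM.exists_eq_graph
    exact ⟨L, (hdom L).1 hD⟩
  · exact fun ⟨L, hL⟩ => ⟨_, isLagrangian_graph L, (hdom L).2 hL⟩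

end IsBoundarySystem

end BoundarySystem

/-! ### Primitives of locally integrable functions -/

namespace IntervalSobolev

open MeasureTheory Set Filter Topology

section Primitive

variable {E : Type*} [NormedAddCommGroup E] [NormedSpace ℝ E]

/-- `F` is a primitive of the locally integrable function `f` on the real line, in the sense of
Lebesgue integration; equivalently, `F` is locally absolutely continuous with derivative `f`. -/
structure IsPrimitive (F f : ℝ → E) : Prop where
  locallyIntegrable : LocallyIntegrable f volume
  sub_eq_integral : ∀ x y, F y - F x = ∫ t in x..y, f t

theorem isPrimitive_intervalIntegral {f : ℝ → E} (hf : LocallyIntegrable f volume) (c : ℝ) :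
    IsPrimitive (fun x => ∫ t in c..x, f t) f := by
  have hf_int (a b : ℝ) : IntervalIntegrable f volume a b :=
    (hf.integrableOn_isCompact isCompact_uIcc).intervalIntegrable
  exact ⟨hf, fun _ _ => intervalIntegral.integral_interval_sub_left (hf_int _ _) (hf_int _ _)⟩

namespace IsPrimitive

variable {F f : ℝ → E}

theorem intervalIntegrable (hF : IsPrimitive F f) (a b : ℝ) : IntervalIntegrable f volume a b :=
  (hF.locallyIntegrable.integrableOn_isCompact isCompact_uIcc).intervalIntegrable

theorem eq_add_integral (hF : IsPrimitive F f) (c x : ℝ) : F x = F c + ∫ t in c..x, f t :=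
  sub_eq_iff_eq_add'.1 (hF.sub_eq_integral c x)

theorem continuous (hF : IsPrimitive F f) : Continuous F := by
  rw [funext (hF.eq_add_integral 0)]
  exact continuous_const.add (intervalIntegral.continuous_primitive hF.intervalIntegrable 0)

theorem ae_hasDerivAt [CompleteSpace E] (hF : IsPrimitive F f) :
    ∀ᵐ x, HasDerivAt F (f x) x := by
  filter_upwards [_root_.LocallyIntegrable.ae_hasDerivAt_integral hF.locallyIntegrable] with x hx
  rw [funext (hF.eq_add_integral 0)]
  exact (hx 0).const_add _

theorem absolutelyContinuousOnInterval (hF : IsPrimitive F f) (a b : ℝ) :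
    AbsolutelyContinuousOnInterval F a b := by
  have hi (x y : ℝ) : IntervalIntegrable (fun t => ‖f t‖) volume x y :=
    (hF.intervalIntegrable x y).norm
  -- The sums that define absolute continuity of `F` are dominated by those of `∫ t in a..x, ‖f t‖`.
  refine squeeze_zero (fun _ => Finset.sum_nonneg fun _ _ => dist_nonneg)
    (fun u => Finset.sum_le_sum fun i _ => ?_)
    ((hi a b).absolutelyContinuousOnInterval_intervalIntegral (c := a) left_mem_uIcc)
  rw [dist_comm, dist_eq_norm, hF.sub_eq_integral, dist_comm, Real.dist_eq,
    intervalIntegral.integral_interval_sub_left (hi _ _) (hi _ _)]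
  exact intervalIntegral.norm_integral_le_abs_integral_norm

theorem clm_comp {E' : Type*} [NormedAddCommGroup E'] [NormedSpace ℝ E'] [CompleteSpace E]
    [CompleteSpace E'] (hF : IsPrimitive F f) (T : E →L[ℝ] E') :
    IsPrimitive (fun x => T (F x)) (fun x => T (f x)) where
  locallyIntegrable x := by
    obtain ⟨s, hs, h⟩ := hF.locallyIntegrable x
    exact ⟨s, hs, T.integrable_comp h⟩
  sub_eq_integral x y := by
    rw [← map_sub, hF.sub_eq_integral, T.intervalIntegral_comp_comm (hF.intervalIntegrable x y)]

end IsPrimitive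

theorem isPrimitive_of_ae_hasDerivAt [CompleteSpace E] {F f : ℝ → E}
    (hf : LocallyIntegrable f volume) (hF : ∀ a b, AbsolutelyContinuousOnInterval F a b)
    (hderiv : ∀ᵐ x, HasDerivAt F (f x) x) : IsPrimitive F f := by
  refine ⟨hf, fun x y => ?_⟩
  have hP := isPrimitive_intervalIntegral hf x
  obtain ⟨C, hC⟩ := ((hF x y).sub
    (hP.absolutelyContinuousOnInterval x y)).const_of_ae_hasDerivAt_zero (by
      filter_upwards [hderiv, hP.ae_hasDerivAt] with z h₁ h₂ _
      simpa using h₁.sub h₂)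
  have hx := hC x left_mem_uIcc
  have hy := hC y right_mem_uIcc
  simp only [Pi.sub_apply, intervalIntegral.integral_same, sub_zero] at hx hy
  rw [hx, ← hy, sub_sub_cancel]

namespace IsPrimitive

theorem smul {𝕜 : Type*} [RCLike 𝕜] [NormedSpace 𝕜 E] [IsScalarTower ℝ 𝕜 E] [CompleteSpace E]
    {F f : ℝ → 𝕜} {G g : ℝ → E} (hF : IsPrimitive F f) (hG : IsPrimitive G g) :
    IsPrimitive (fun x => F x • G x) (fun x => F x • g x + f x • G x) := by
  refine isPrimitive_of_ae_hasDerivAt ?_ (fun a b => (hF.absolutelyContinuousOnInterval a b).smul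
    (hG.absolutelyContinuousOnInterval a b)) ?_
  · exact (hG.locallyIntegrable.continuous_smul hF.continuous).add
      (hF.locallyIntegrable.smul_continuous hG.continuous)
  · filter_upwards [hF.ae_hasDerivAt, hG.ae_hasDerivAt] with x hFx hGx
    exact hFx.smul hGx

theorem inner {𝕜 : Type*} [RCLike 𝕜] {F f G g : ℝ → 𝕜} (hF : IsPrimitive F f)
    (hG : IsPrimitive G g) :
    IsPrimitive (fun x => inner 𝕜 (F x) (G x))
      (fun x => inner 𝕜 (F x) (g x) + inner 𝕜 (f x) (G x)) := by
  simp only [RCLike.inner_apply']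
  exact (hF.clm_comp (RCLike.conjCLE (K := 𝕜)).toContinuousLinearMap).smul hG

variable {F f : ℝ → E}

theorem integral_eq_sub_of_tendsto (hF : IsPrimitive F f) (hf : Integrable f) {m n : E}
    (hbot : Tendsto F atBot (𝓝 m)) (htop : Tendsto F atTop (𝓝 n)) : ∫ x, f x = n - m := by
  refine tendsto_nhds_unique
    (intervalIntegral_tendsto_integral hf tendsto_neg_atTop_atBot tendsto_id) ?_
  simp_rw [← hF.sub_eq_integral]
  exact (htop.comp tendsto_id).sub (hbot.comp tendsto_neg_atTop_atBot)

theorem tendsto_atTop_of_forall_gt_eq_zero (hF : IsPrimitive F f) {b : ℝ}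
    (hf : ∀ x, b < x → f x = 0) : Tendsto F atTop (𝓝 (F b)) := by
  refine tendsto_const_nhds.congr' ?_
  filter_upwards [eventually_ge_atTop b] with x hx
  rw [hF.eq_add_integral b x, intervalIntegral.integral_of_le hx,
    setIntegral_eq_zero_of_forall_eq_zero fun t ht => hf t ht.1, add_zero]

theorem tendsto_atTop_zero (hF : IsPrimitive F f) (hf : Integrable f)
    (hF_int : IntegrableAtFilter F atTop volume) : Tendsto F atTop (𝓝 0) := by
  have hlim : Tendsto F atTop (𝓝 (F 0 + ∫ t in Ioi 0, f t)) := by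
    rw [funext (hF.eq_add_integral 0)]
    simpa using tendsto_const_nhds.add
      (intervalIntegral_tendsto_integral_Ioi 0 hf.integrableOn tendsto_id)
  have hvol : ∀ s ∈ (atTop : Filter ℝ), volume s = ⊤ := fun s hs => by
    obtain ⟨d, hd⟩ := mem_atTop_sets.1 hs
    exact top_le_iff.1 (Real.volume_Ici (a := d) ▸ measure_mono hd)
  rwa [IntegrableAtFilter.eq_zero_of_tendsto hF_int hvol hlim] at hlim

theorem tendsto_atBot_of_forall_le_eq_zero (hF : IsPrimitive F f) {a : ℝ}
    (hf : ∀ x ≤ a, f x = 0) : Tendsto F atBot (𝓝 (F a)) := by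
  refine tendsto_const_nhds.congr' ?_
  filter_upwards [eventually_le_atBot a] with x hx
  rw [hF.eq_add_integral x a, intervalIntegral.integral_of_le hx,
    setIntegral_eq_zero_of_forall_eq_zero fun t ht => hf t ht.2, add_zero]

theorem tendsto_atBot_zero (hF : IsPrimitive F f) (hf : Integrable f)
    (hF_int : IntegrableAtFilter F atBot volume) : Tendsto F atBot (𝓝 0) := by
  have hlim : Tendsto F atBot (𝓝 (F 0 - ∫ t in Iic 0, f t)) := by
    rw [funext (hF.eq_add_integral 0)]
    simpa [intervalIntegral.integral_symm _ (0 : ℝ), sub_eq_add_neg] using tendsto_const_nhds.add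
      (intervalIntegral_tendsto_integral_Iic 0 hf.integrableOn tendsto_id).neg
  have hvol : ∀ s ∈ (atBot : Filter ℝ), volume s = ⊤ := fun s hs => by
    obtain ⟨d, hd⟩ := mem_atBot_sets.1 hs
    exact top_le_iff.1 (Real.volume_Iic (a := d) ▸ measure_mono hd)
  rwa [IntegrableAtFilter.eq_zero_of_tendsto hF_int hvol hlim] at hlim

end IsPrimitive

end Primitive

end IntervalSobolev

/-! ### Green's formula -/

namespace MetricGraph

open IntervalSobolev
open MeasureTheory Set Filter Topology

variable {V E : Type*} {Γ : MetricGraph V E} {𝕜 : Type*} [RCLike 𝕜] {e : E}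

theorem coe_toReal_a (he : e ∈ Γ.leftEdges) : ((Γ.a e).toReal : EReal) = Γ.a e :=
  EReal.coe_toReal (ne_top_of_lt (Γ.a_lt_b e)) (LT.lt.ne' he)

theorem coe_toReal_b (he : e ∈ Γ.rightEdges) : ((Γ.b e).toReal : EReal) = Γ.b e :=
  EReal.coe_toReal (LT.lt.ne he) (ne_bot_of_gt (Γ.a_lt_b e))

theorem notMem_interval_of_le_toReal_a (he : e ∈ Γ.leftEdges) {x : ℝ} (hx : x ≤ (Γ.a e).toReal) :
    x ∉ Γ.interval e :=
  fun h => (h.1.trans_le (EReal.coe_le_coe_iff.2 hx)).ne (coe_toReal_a he).symm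

theorem notMem_interval_of_toReal_b_le (he : e ∈ Γ.rightEdges) {x : ℝ} (hx : (Γ.b e).toReal ≤ x) :
    x ∉ Γ.interval e :=
  fun h => ((EReal.coe_le_coe_iff.2 hx).trans_lt h.2).ne (coe_toReal_b he)

theorem toReal_a_mem_closure_interval (he : e ∈ Γ.leftEdges) :
    (Γ.a e).toReal ∈ closure (Γ.interval e) := by
  obtain ⟨c, hac, hcb⟩ := EReal.lt_iff_exists_real_btwn.1 (Γ.a_lt_b e)
  rw [← coe_toReal_a he, EReal.coe_lt_coe_iff] at hac
  have hIoo : Ioo (Γ.a e).toReal c ⊆ Γ.interval e := fun x hx =>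
    ⟨coe_toReal_a he ▸ EReal.coe_lt_coe_iff.2 hx.1, (EReal.coe_lt_coe_iff.2 hx.2).trans hcb⟩
  exact closure_mono hIoo (closure_Ioo hac.ne ▸ left_mem_Icc.2 hac.le)

theorem toReal_b_mem_closure_interval (he : e ∈ Γ.rightEdges) :
    (Γ.b e).toReal ∈ closure (Γ.interval e) := by
  obtain ⟨c, hac, hcb⟩ := EReal.lt_iff_exists_real_btwn.1 (Γ.a_lt_b e)
  rw [← coe_toReal_b he, EReal.coe_lt_coe_iff] at hcb
  have hIoo : Ioo c (Γ.b e).toReal ⊆ Γ.interval e := fun x hx =>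
    ⟨hac.trans (EReal.coe_lt_coe_iff.2 hx.1), coe_toReal_b he ▸ EReal.coe_lt_coe_iff.2 hx.2⟩
  exact closure_mono hIoo (closure_Ioo hcb.ne ▸ right_mem_Icc.2 hcb.le)

section Primitive

variable {X : Type*} [NormedAddCommGroup X] [NormedSpace ℝ X] {F f : ℝ → X}

theorem tendsto_atTop_of_isPrimitive (hF : IsPrimitive F ((Γ.interval e).indicator f))
    (hF_int : IntegrableOn F (Γ.interval e)) (hf_int : IntegrableOn f (Γ.interval e)) :
    Tendsto F atTop (𝓝 (Γ.rightEdges.indicator (fun e => F (Γ.b e).toReal) e)) := by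
  by_cases he : e ∈ Γ.rightEdges
  · rw [indicator_of_mem he]
    exact hF.tendsto_atTop_of_forall_gt_eq_zero fun x hx =>
      indicator_of_notMem (notMem_interval_of_toReal_b_le he hx.le) _
  · rw [indicator_of_notMem he]
    obtain ⟨c, hac, -⟩ := EReal.lt_iff_exists_real_btwn.1 (Γ.a_lt_b e)
    have hb : Γ.b e = ⊤ := not_lt_top_iff.1 he
    have hIoi : Ioi c ⊆ Γ.interval e := fun x hx =>
      ⟨hac.trans (EReal.coe_lt_coe_iff.2 hx), hb ▸ EReal.coe_lt_top x⟩
    exact hF.tendsto_atTop_zero (hf_int.integrable_indicator (Γ.isOpen_interval e).measurableSet)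
      ⟨Ioi c, Ioi_mem_atTop c, hF_int.mono_set hIoi⟩

theorem tendsto_atBot_of_isPrimitive (hF : IsPrimitive F ((Γ.interval e).indicator f))
    (hF_int : IntegrableOn F (Γ.interval e)) (hf_int : IntegrableOn f (Γ.interval e)) :
    Tendsto F atBot (𝓝 (Γ.leftEdges.indicator (fun e => F (Γ.a e).toReal) e)) := by
  by_cases he : e ∈ Γ.leftEdges
  · rw [indicator_of_mem he]
    exact hF.tendsto_atBot_of_forall_le_eq_zero fun x hx =>
      indicator_of_notMem (notMem_interval_of_le_toReal_a he hx) _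
  · rw [indicator_of_notMem he]
    obtain ⟨c, -, hcb⟩ := EReal.lt_iff_exists_real_btwn.1 (Γ.a_lt_b e)
    have ha : Γ.a e = ⊥ := not_bot_lt_iff.1 he
    have hIio : Iio c ⊆ Γ.interval e := fun x hx =>
      ⟨ha ▸ EReal.bot_lt_coe x, (EReal.coe_lt_coe_iff.2 hx).trans hcb⟩
    exact hF.tendsto_atBot_zero (hf_int.integrable_indicator (Γ.isOpen_interval e).measurableSet)
      ⟨Iio c, Iio_mem_atBot c, hF_int.mono_set hIio⟩

theorem setIntegral_interval_eq_sub (hF : IsPrimitive F ((Γ.interval e).indicator f))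
    (hF_int : IntegrableOn F (Γ.interval e)) (hf_int : IntegrableOn f (Γ.interval e)) :
    ∫ x in Γ.interval e, f x =
      Γ.rightEdges.indicator (fun e => F (Γ.b e).toReal) e -
        Γ.leftEdges.indicator (fun e => F (Γ.a e).toReal) e := by
  have hIm := (Γ.isOpen_interval e).measurableSet
  rw [← integral_indicator hIm]
  exact hF.integral_eq_sub_of_tendsto (hf_int.integrable_indicator hIm)
    (tendsto_atBot_of_isPrimitive hF hF_int hf_int) (tendsto_atTop_of_isPrimitive hF hF_int hf_int)

end Primitive

/-- The continuous representative of the component `f_e`, so that `edgeRep f e p` is the value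
`f_e(p)` used in the traces. -/
noncomputable def edgeRep (f : Γ.L2Space 𝕜) (e : E) : ℝ → 𝕜 := contRep (Γ.interval e) (f e)

theorem exists_isPrimitive (f : (Γ.maxDeriv 𝕜).domain) (e : E) :
    ∃ F, IsPrimitive F ((Γ.interval e).indicator (Γ.maxDeriv 𝕜 f e)) ∧
      F =ᵐ[volume.restrict (Γ.interval e)] (f : Γ.L2Space 𝕜) e ∧
      EqOn (edgeRep (f : Γ.L2Space 𝕜) e) F (closure (Γ.interval e)) := by
  obtain ⟨F, -, hFf, hF, hF_rep⟩ := exists_rep f e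
  have h_memLp := (memLp_indicator_iff_restrict (Γ.isOpen_interval e).measurableSet).2
    (Lp.memLp (Γ.maxDeriv 𝕜 f e))
  exact ⟨F, ⟨h_memLp.locallyIntegrable (by norm_num), hF⟩, hFf, hF_rep⟩

theorem inner_maxDeriv_apply_add_inner_maxDeriv_apply (f g : (Γ.maxDeriv 𝕜).domain) (e : E) :
    inner 𝕜 (Γ.maxDeriv 𝕜 f e) ((g : Γ.L2Space 𝕜) e) +
        inner 𝕜 ((f : Γ.L2Space 𝕜) e) (Γ.maxDeriv 𝕜 g e) =
      Γ.rightEdges.indicator (fun e =>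
        inner 𝕜 (edgeRep (f : Γ.L2Space 𝕜) e (Γ.b e).toReal)
          (edgeRep (g : Γ.L2Space 𝕜) e (Γ.b e).toReal)) e -
      Γ.leftEdges.indicator (fun e =>
        inner 𝕜 (edgeRep (f : Γ.L2Space 𝕜) e (Γ.a e).toReal)
          (edgeRep (g : Γ.L2Space 𝕜) e (Γ.a e).toReal)) e := by
  obtain ⟨F, hF, hFf, hF_rep⟩ := exists_isPrimitive f e
  obtain ⟨G, hG, hGg, hG_rep⟩ := exists_isPrimitive g e
  have hFG : (fun x => inner 𝕜 (F x) (G x)) =ᵐ[volume.restrict (Γ.interval e)]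
      fun x => inner 𝕜 ((f : Γ.L2Space 𝕜) e x) ((g : Γ.L2Space 𝕜) e x) :=
    hFf.comp₂ (inner 𝕜) hGg
  have hFG' : (fun x => inner 𝕜 (Γ.maxDeriv 𝕜 f e x) (G x) + inner 𝕜 (F x) (Γ.maxDeriv 𝕜 g e x))
      =ᵐ[volume.restrict (Γ.interval e)]
      fun x => inner 𝕜 (Γ.maxDeriv 𝕜 f e x) ((g : Γ.L2Space 𝕜) e x) +
        inner 𝕜 ((f : Γ.L2Space 𝕜) e x) (Γ.maxDeriv 𝕜 g e x) := by
    filter_upwards [hFf, hGg] with x hx hx'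
    rw [hx, hx']
  have hf_int := L2.integrable_inner (𝕜 := 𝕜) (Γ.maxDeriv 𝕜 f e) ((g : Γ.L2Space 𝕜) e)
  have hg_int := L2.integrable_inner (𝕜 := 𝕜) ((f : Γ.L2Space 𝕜) e) (Γ.maxDeriv 𝕜 g e)
  have hprim : IsPrimitive (fun x => inner 𝕜 (F x) (G x)) ((Γ.interval e).indicator fun x =>
      inner 𝕜 (Γ.maxDeriv 𝕜 f e x) (G x) + inner 𝕜 (F x) (Γ.maxDeriv 𝕜 g e x)) := by
    convert hF.inner hG using 2 with x
    by_cases hx : x ∈ Γ.interval e <;> simp [hx, add_comm]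
  rw [L2.inner_def, L2.inner_def, ← integral_add hf_int hg_int, ← integral_congr_ae hFG',
    setIntegral_interval_eq_sub hprim ((integrable_congr hFG).2 (L2.integrable_inner _ _))
      ((integrable_congr hFG').2 (hf_int.add hg_int))]
  congr 1
  · by_cases he : e ∈ Γ.rightEdges
    · have hcl := toReal_b_mem_closure_interval he
      simp only [indicator_of_mem he, hF_rep hcl, hG_rep hcl]
    · simp only [indicator_of_notMem he]
  · by_cases he : e ∈ Γ.leftEdges
    · have hcl := toReal_a_mem_closure_interval he
      simp only [indicator_of_mem he, hF_rep hcl, hG_rep hcl]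
    · simp only [indicator_of_notMem he]

theorem inner_maxDeriv_add_inner_maxDeriv (hΓ : 0 < ⨅ e, (Γ.b e - Γ.a e))
    (f g : (Γ.maxDeriv 𝕜).domain) :
    inner 𝕜 (Γ.maxDeriv 𝕜 f) (g : Γ.L2Space 𝕜) + inner 𝕜 (f : Γ.L2Space 𝕜) (Γ.maxDeriv 𝕜 g) =
      inner 𝕜 (Γ.rightTrace 𝕜 hΓ f) (Γ.rightTrace 𝕜 hΓ g) -
        inner 𝕜 (Γ.leftTrace 𝕜 hΓ f) (Γ.leftTrace 𝕜 hΓ g) := by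
  have hright := (hasSum_subtype_iff_indicator (s := Γ.rightEdges) (f := fun e =>
    inner 𝕜 (edgeRep (f : Γ.L2Space 𝕜) e (Γ.b e).toReal)
      (edgeRep (g : Γ.L2Space 𝕜) e (Γ.b e).toReal))).1
    (lp.hasSum_inner (𝕜 := 𝕜) (Γ.rightTrace 𝕜 hΓ f) (Γ.rightTrace 𝕜 hΓ g))
  have hleft := (hasSum_subtype_iff_indicator (s := Γ.leftEdges) (f := fun e =>
    inner 𝕜 (edgeRep (f : Γ.L2Space 𝕜) e (Γ.a e).toReal)
      (edgeRep (g : Γ.L2Space 𝕜) e (Γ.a e).toReal))).1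
    (lp.hasSum_inner (𝕜 := 𝕜) (Γ.leftTrace 𝕜 hΓ f) (Γ.leftTrace 𝕜 hΓ g))
  refine HasSum.unique ?_ (hright.sub hleft)
  simp_rw [← inner_maxDeriv_apply_add_inner_maxDeriv_apply f g]
  exact (lp.hasSum_inner _ _).add (lp.hasSum_inner _ _)

end MetricGraph

/-! ### Joint surjectivity of the traces -/

theorem memℓp_extend {ι κ X : Type*} [NormedAddCommGroup X] {p : ENNReal} (hp : 0 < p.toReal)
    {i : ι → κ} (hi : i.Injective) {u : ι → X} (hu : Memℓp u p) :
    Memℓp (Function.extend i u 0) p := by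
  have h_extend : (fun k => ‖Function.extend i u 0 k‖ ^ p.toReal) =
      Function.extend i (fun j => ‖u j‖ ^ p.toReal) 0 := by
    ext k
    by_cases hk : ∃ j, i j = k
    · obtain ⟨j, rfl⟩ := hk
      simp only [hi.extend_apply]
    · simp only [Function.extend_apply' _ _ _ hk, Pi.zero_apply, norm_zero, Real.zero_rpow hp.ne']
  rw [memℓp_gen_iff hp, h_extend, summable_extend_zero hi]
  exact hu.summable hp

theorem exists_lp_eq_on_and_eq_zero_off {ι X : Type*} [NormedAddCommGroup X] {p : ENNReal}
    (hp : 0 < p.toReal) {S : Set ι} (ξ : lp (fun _ : S => X) p) :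
    ∃ c : lp (fun _ : ι => X) p, (∀ i : S, c i = ξ i) ∧ ∀ i ∉ S, c i = 0 :=
  ⟨⟨_, memℓp_extend hp Subtype.val_injective (lp.memℓp ξ)⟩,
    Subtype.val_injective.extend_apply _ _,
    fun _ hi => Function.extend_apply' _ _ _ fun ⟨j, h⟩ => hi (h ▸ j.2)⟩

namespace IntervalSobolev

open MeasureTheory Set Filter Topology
open scoped ContDiff

theorem isPrimitive_deriv {E : Type*} [NormedAddCommGroup E] [NormedSpace ℝ E] [CompleteSpace E]
    {F : ℝ → E} (hF : ContDiff ℝ 1 F) : IsPrimitive F (deriv F) := by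
  have hF' : Continuous (deriv F) := hF.continuous_deriv le_rfl
  exact ⟨hF'.locallyIntegrable, fun x y => (intervalIntegral.integral_deriv_eq_sub
    (fun t _ => hF.differentiable one_ne_zero t) (hF'.intervalIntegrable x y)).symm⟩

theorem IsPrimitive.hasWeakDeriv {𝕜 : Type*} [RCLike 𝕜] {F f : ℝ → 𝕜} (hF : IsPrimitive F f)
    (I : Set ℝ) : HasWeakDeriv I F f := by
  intro φ hφ hφc hφI
  have hφ1 : ContDiff ℝ 1 φ := hφ.of_le (by exact_mod_cast le_top)
  have hint : Integrable (fun x => φ x • f x) :=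
    hF.locallyIntegrable.integrable_smul_left_of_hasCompactSupport hφ.continuous hφc
  have hint' : Integrable (fun x => deriv φ x • F x) :=
    hF.continuous.locallyIntegrable.integrable_smul_left_of_hasCompactSupport
      (hφ1.continuous_deriv le_rfl) hφc.deriv
  have hlim : Tendsto (fun x => φ x • F x) (cocompact ℝ) (𝓝 0) :=
    (hφc.smul_right (f' := F)).is_zero_at_infty
  have hzero := ((isPrimitive_deriv hφ1).smul hF).integral_eq_sub_of_tendsto (hint.add hint')
    (hlim.mono_left atBot_le_cocompact) (hlim.mono_left atTop_le_cocompact)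
  rw [sub_zero, integral_add hint hint', add_comm] at hzero
  rw [setIntegral_eq_integral_of_forall_compl_eq_zero fun x hx => by
      rw [image_eq_zero_of_notMem_tsupport fun h => hx (hφI (tsupport_deriv_subset h)), zero_smul],
    setIntegral_eq_integral_of_forall_compl_eq_zero fun x hx => by
      rw [image_eq_zero_of_notMem_tsupport fun h => hx (hφI h), zero_smul]]
  exact eq_neg_of_add_eq_zero_left hzero

theorem exists_contDiff_hasCompactSupport_of_pos {l : ℝ} (hl : 0 < l) :
    ∃ ψ : ℝ → ℝ, ContDiff ℝ 1 ψ ∧ HasCompactSupport ψ ∧ ψ 0 = 1 ∧ ∀ x, l ≤ |x| → ψ x = 0 := by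
  let ψ : ContDiffBump (0 : ℝ) := ⟨l / 2, l, half_pos hl, half_lt_self hl⟩
  exact ⟨ψ, ψ.contDiff, ψ.hasCompactSupport,
    ψ.one_of_mem_closedBall (Metric.mem_closedBall_self ψ.rIn_pos.le),
    fun x hx => ψ.zero_of_le_dist (by rwa [Real.dist_0_eq_abs])⟩

end IntervalSobolev

namespace MetricGraph

open IntervalSobolev
open MeasureTheory Set Filter Topology
open scoped ContDiff

variable {V E : Type*} {Γ : MetricGraph V E} {𝕜 : Type*} [RCLike 𝕜]

theorem exists_forall_ae_eq_translate {ψ : ℝ → ℝ} (hψ : MemLp ψ 2) (p : E → ℝ)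
    (c : lp (fun _ : E => 𝕜) 2) :
    ∃ f : Γ.L2Space 𝕜, ∀ e, f e =ᵐ[volume.restrict (Γ.interval e)] fun x => ψ (x - p e) • c e := by
  have hψ_translate (e : E) : MemLp (fun x => ψ (x - p e) • c e) 2 :=
    (ContinuousLinearMap.toSpanSingleton ℝ (c e)).comp_memLp'
      (hψ.comp_measurePreserving (measurePreserving_sub_right volume (p e)))
  have h_le (e : E) : eLpNorm (fun x => ψ (x - p e) • c e) 2 (volume.restrict (Γ.interval e)) ≤
      ENNReal.ofReal ‖c e‖ * eLpNorm ψ 2 volume := by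
    refine (eLpNorm_mono_measure _ Measure.restrict_le_self).trans ?_
    rw [← eLpNorm_comp_measurePreserving hψ.1 (measurePreserving_sub_right volume (p e))]
    refine eLpNorm_le_mul_eLpNorm_of_ae_le_mul (ae_of_all _ fun x => ?_) 2
    exact (norm_smul _ _).trans_le (mul_comm _ _).le
  have h_norm (e : E) : ‖((hψ_translate e).restrict (Γ.interval e)).toLp _‖ ≤
      ‖(((eLpNorm ψ 2 volume).toReal : 𝕜) • c) e‖ := by
    rw [Lp.norm_toLp, lp.coeFn_smul, Pi.smul_apply, norm_smul,
      RCLike.norm_of_nonneg ENNReal.toReal_nonneg, mul_comm]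
    refine (ENNReal.toReal_mono (ENNReal.mul_lt_top ENNReal.ofReal_lt_top hψ.2).ne
      (h_le e)).trans_eq ?_
    rw [ENNReal.toReal_mul, ENNReal.toReal_ofReal (norm_nonneg _)]
  exact ⟨⟨fun e => ((hψ_translate e).restrict (Γ.interval e)).toLp _, (lp.memℓp _).mono' h_norm⟩,
    fun e => ((hψ_translate e).restrict (Γ.interval e)).coeFn_toLp⟩

theorem exists_mem_domain_translate {ψ : ℝ → ℝ} (hψ : ContDiff ℝ 1 ψ) (hψc : HasCompactSupport ψ)
    (p : E → ℝ) (c : lp (fun _ : E => 𝕜) 2) :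
    ∃ f : (Γ.maxDeriv 𝕜).domain,
      (∀ e, (f : Γ.L2Space 𝕜) e =ᵐ[volume.restrict (Γ.interval e)] fun x => ψ (x - p e) • c e) ∧
      (∀ e, Γ.maxDeriv 𝕜 f e =ᵐ[volume.restrict (Γ.interval e)]
        fun x => deriv ψ (x - p e) • c e) ∧
      ∀ e, EqOn (edgeRep (f : Γ.L2Space 𝕜) e) (fun x => ψ (x - p e) • c e)
        (closure (Γ.interval e)) := by
  obtain ⟨f, hf⟩ := exists_forall_ae_eq_translate (Γ := Γ)
    (hψ.continuous.memLp_of_hasCompactSupport hψc) p c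
  obtain ⟨g, hg⟩ := exists_forall_ae_eq_translate (Γ := Γ)
    ((hψ.continuous_deriv le_rfl).memLp_of_hasCompactSupport hψc.deriv) p c
  have h_translate (e : E) : ContDiff ℝ 1 fun x => ψ (x - p e) • c e := by fun_prop
  have h_deriv (e : E) : deriv (fun x => ψ (x - p e) • c e) = fun x => deriv ψ (x - p e) • c e := by
    ext x
    have hd := hψ.differentiable one_ne_zero (x - p e)
    exact (hd.hasDerivAt.comp_sub_const x (p e)).smul_const (c e) |>.deriv
  have hfg : IsDeriv f g := fun e =>
    (h_deriv e ▸ (isPrimitive_deriv (h_translate e)).hasWeakDeriv _).congr_ae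
      (hf e).symm (hg e).symm
  refine ⟨⟨f, g, hfg⟩, hf, fun e => ?_, fun e => ?_⟩
  · rw [(Γ.maxDeriv_spec 𝕜 ⟨f, g, hfg⟩).unique hfg]
    exact hg e
  · exact contRep_eq (Γ.isOpen_interval e) (h_translate e).continuous.continuousOn (hf e).symm

theorem exists_le_toReal_sub_toReal (hΓ : 0 < ⨅ e, (Γ.b e - Γ.a e)) :
    ∃ l > 0, ∀ e ∈ Γ.leftEdges, e ∈ Γ.rightEdges → l ≤ (Γ.b e).toReal - (Γ.a e).toReal := by
  obtain ⟨l, hl, hle⟩ := exists_length hΓ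
  refine ⟨l, hl, fun e ha hb => EReal.coe_le_coe_iff.1 ?_⟩
  rw [EReal.coe_sub, coe_toReal_a ha, coe_toReal_b hb]
  exact hle e

theorem exists_rightTrace_eq_and_leftTrace_eq_zero (hΓ : 0 < ⨅ e, (Γ.b e - Γ.a e))
    (ξ : lp (fun _ : Γ.rightEdges => 𝕜) 2) :
    ∃ f, Γ.rightTrace 𝕜 hΓ f = ξ ∧ Γ.leftTrace 𝕜 hΓ f = 0 := by
  obtain ⟨l, hl, hle⟩ := exists_le_toReal_sub_toReal hΓ
  obtain ⟨ψ, hψ, hψc, hψ_one, hψ_zero⟩ := exists_contDiff_hasCompactSupport_of_pos hl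
  -- As `l` is a lower bound of the edge lengths, a cutoff `ψ (x - b_e)` vanishes at `a_e`.
  obtain ⟨c, hc, hc_zero⟩ := exists_lp_eq_on_and_eq_zero_off (by norm_num) ξ
  obtain ⟨f, -, -, hf⟩ := exists_mem_domain_translate (Γ := Γ) hψ hψc (fun e => (Γ.b e).toReal) c
  refine ⟨f, lp.ext (funext fun e => ?_), lp.ext (funext fun e => ?_)⟩
  · refine (hf e (toReal_b_mem_closure_interval e.2)).trans ?_
    simp only [sub_self, hψ_one, one_smul, hc]
  · refine (hf e (toReal_a_mem_closure_interval e.2)).trans ?_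
    by_cases he : (e : E) ∈ Γ.rightEdges
    · simp only
      rw [hψ_zero _ (abs_sub_comm (Γ.b e).toReal _ ▸ (hle e e.2 he).trans (le_abs_self _)),
        zero_smul, lp.coeFn_zero, Pi.zero_apply]
    · simp only [hc_zero _ he, smul_zero, lp.coeFn_zero, Pi.zero_apply]

theorem exists_rightTrace_eq_zero_and_leftTrace_eq (hΓ : 0 < ⨅ e, (Γ.b e - Γ.a e))
    (η : lp (fun _ : Γ.leftEdges => 𝕜) 2) :
    ∃ f, Γ.rightTrace 𝕜 hΓ f = 0 ∧ Γ.leftTrace 𝕜 hΓ f = η := by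
  obtain ⟨l, hl, hle⟩ := exists_le_toReal_sub_toReal hΓ
  obtain ⟨ψ, hψ, hψc, hψ_one, hψ_zero⟩ := exists_contDiff_hasCompactSupport_of_pos hl
  obtain ⟨c, hc, hc_zero⟩ := exists_lp_eq_on_and_eq_zero_off (by norm_num) η
  obtain ⟨f, -, -, hf⟩ := exists_mem_domain_translate (Γ := Γ) hψ hψc (fun e => (Γ.a e).toReal) c
  refine ⟨f, lp.ext (funext fun e => ?_), lp.ext (funext fun e => ?_)⟩
  · refine (hf e (toReal_b_mem_closure_interval e.2)).trans ?_
    by_cases he : (e : E) ∈ Γ.leftEdges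
    · simp only
      rw [hψ_zero _ ((hle e he e.2).trans (le_abs_self _)),
        zero_smul, lp.coeFn_zero, Pi.zero_apply]
    · simp only [hc_zero _ he, smul_zero, lp.coeFn_zero, Pi.zero_apply]
  · refine (hf e (toReal_a_mem_closure_interval e.2)).trans ?_
    simp only [sub_self, hψ_one, one_smul, hc]

theorem surjective_prod_traces (hΓ : 0 < ⨅ e, (Γ.b e - Γ.a e)) :
    Function.Surjective ((Γ.rightTrace 𝕜 hΓ).prod (Γ.leftTrace 𝕜 hΓ)) := by
  rintro ⟨ξ, η⟩
  obtain ⟨f, hf_right, hf_left⟩ := exists_rightTrace_eq_and_leftTrace_eq_zero hΓ ξ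
  obtain ⟨g, hg_right, hg_left⟩ := exists_rightTrace_eq_zero_and_leftTrace_eq hΓ η
  refine ⟨f + g, Prod.ext ?_ ?_⟩
  · exact (map_add _ f g).trans (by rw [hf_right, hg_right, add_zero])
  · exact (map_add _ f g).trans (by rw [hf_left, hg_left, zero_add])

end MetricGraph

/-! ### The boundary system of traces -/

namespace MetricGraph

open IntervalSobolev
open MeasureTheory Set Filter Topology
open scoped ContDiff

variable {V E : Type*} {Γ : MetricGraph V E} {𝕜 : Type*} [RCLike 𝕜]

theorem inner_eq_setIntegral_of_ae_eq {f g : Γ.L2Space 𝕜} {e : E} {φ : ℝ → ℝ}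
    (hf : f e =ᵐ[volume.restrict (Γ.interval e)] fun x => (φ x : 𝕜))
    (hf_zero : ∀ e' ≠ e, f e' = 0) :
    inner 𝕜 f g = ∫ x in Γ.interval e, φ x • g e x := by
  rw [lp.inner_eq_tsum, tsum_eq_single e fun e' he' => by rw [hf_zero e' he', inner_zero_left],
    L2.inner_def]
  refine integral_congr_ae (hf.mono fun x hx => ?_)
  simp only [hx, RCLike.inner_apply', RCLike.conj_ofReal, RCLike.real_smul_eq_coe_mul]

theorem exists_mem_domain_testFunction {e : E} {φ : ℝ → ℝ} (hφ : ContDiff ℝ 1 φ)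
    (hφc : HasCompactSupport φ) (hφe : tsupport φ ⊆ Γ.interval e) :
    ∃ u : (Γ.maxDeriv 𝕜).domain,
      (∀ g, inner 𝕜 (u : Γ.L2Space 𝕜) g = ∫ x in Γ.interval e, φ x • g e x) ∧
      (∀ g, inner 𝕜 (Γ.maxDeriv 𝕜 u) g = ∫ x in Γ.interval e, deriv φ x • g e x) ∧
      ∀ e', ∀ p ∈ closure (Γ.interval e') \ Γ.interval e', edgeRep (u : Γ.L2Space 𝕜) e' p = 0 := by
  classical
  let c : lp (fun _ : E => 𝕜) 2 := lp.single 2 e 1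
  have hc : c e = 1 := lp.single_apply_self _ _ _
  have hc_ne {e' : E} (he' : e' ≠ e) : c e' = 0 := lp.single_apply_ne _ _ _ he'
  obtain ⟨u, hu, hu', hu_rep⟩ := exists_mem_domain_translate (Γ := Γ) hφ hφc (fun _ => 0) c
  have h_inner {v : Γ.L2Space 𝕜} {ψ : ℝ → ℝ} (hv : ∀ e', v e' =ᵐ[volume.restrict (Γ.interval e')]
      fun x => ψ (x - 0) • c e') (g : Γ.L2Space 𝕜) :
      inner 𝕜 v g = ∫ x in Γ.interval e, ψ x • g e x := by
    refine inner_eq_setIntegral_of_ae_eq ((hv e).mono fun x hx => ?_) fun e' he' =>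
      (Lp.eq_zero_iff_ae_eq_zero).2 ((hv e').mono fun x hx => ?_)
    · simp only [hx, sub_zero, hc, RCLike.real_smul_eq_coe_mul, mul_one]
    · simp only [hx, hc_ne he', smul_zero, Pi.zero_apply]
  refine ⟨u, h_inner hu, h_inner hu', fun e' p hp => ?_⟩
  refine (hu_rep e' hp.1).trans ?_
  rcases eq_or_ne e' e with rfl | he'
  · simp only [sub_zero, image_eq_zero_of_notMem_tsupport fun h => hp.2 (hφe h), zero_smul]
  · simp only [hc_ne he', smul_zero]

theorem mem_graph_maxDeriv {f g : Γ.L2Space 𝕜} (hfg : IsDeriv f g) :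
    (f, g) ∈ (Γ.maxDeriv 𝕜).graph :=
  (Γ.maxDeriv 𝕜).mem_graph_iff.2
    ⟨⟨f, g, hfg⟩, rfl, (Γ.maxDeriv_spec 𝕜 ⟨f, g, hfg⟩).unique hfg⟩

theorem isDeriv_of_forall_inner (hΓ : 0 < ⨅ e, (Γ.b e - Γ.a e)) {f g : Γ.L2Space 𝕜}
    (h : ∀ u, Γ.rightTrace 𝕜 hΓ u = 0 → Γ.leftTrace 𝕜 hΓ u = 0 →
      inner 𝕜 (Γ.maxDeriv 𝕜 u) f + inner 𝕜 (u : Γ.L2Space 𝕜) g = 0) :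
    IsDeriv f g := by
  intro e φ hφ hφc hφe
  obtain ⟨u, hu, hu', hu_zero⟩ := exists_mem_domain_testFunction (𝕜 := 𝕜)
    (hφ.of_le (by exact_mod_cast le_top)) hφc hφe
  have hu_right : Γ.rightTrace 𝕜 hΓ u = 0 := lp.ext (funext fun e => hu_zero e _
    ⟨toReal_b_mem_closure_interval e.2, notMem_interval_of_toReal_b_le e.2 le_rfl⟩)
  have hu_left : Γ.leftTrace 𝕜 hΓ u = 0 := lp.ext (funext fun e => hu_zero e _
    ⟨toReal_a_mem_closure_interval e.2, notMem_interval_of_le_toReal_a e.2 le_rfl⟩)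
  rw [← hu, ← hu']
  exact eq_neg_of_add_eq_zero_left (h u hu_right hu_left)

theorem isBoundarySystem_prod_traces (hΓ : 0 < ⨅ e, (Γ.b e - Γ.a e)) :
    IsBoundarySystem (Γ.maxDeriv 𝕜) ((Γ.rightTrace 𝕜 hΓ).prod (Γ.leftTrace 𝕜 hΓ)) where
  surjective := surjective_prod_traces hΓ
  inner_add_inner_eq_sub := inner_maxDeriv_add_inner_maxDeriv hΓ
  mem_graph_of_forall_inner _ _ h := mem_graph_maxDeriv <| isDeriv_of_forall_inner hΓ
    fun u hu_right hu_left => h u (Prod.ext hu_right hu_left)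

end MetricGraph

theorem mainTheorem2 {𝕜 : Type*} [RCLike 𝕜] {V E : Type*} (Γ : MetricGraph V E)
    (hΓ : 0 < ⨅ e, (Γ.b e - Γ.a e))
    (H : Γ.L2Space 𝕜 →ₗ.[𝕜] Γ.L2Space 𝕜) (hH : H ≤ Γ.maxDeriv 𝕜) :
    H.IsSkewSelfAdjoint ↔
      ∃ L : lp (fun _ : Γ.rightEdges => 𝕜) 2 ≃ₗᵢ[𝕜] lp (fun _ : Γ.leftEdges => 𝕜) 2,
        (H.domain : Set (Γ.L2Space 𝕜)) =
          {f | ∃ hf : f ∈ (Γ.maxDeriv 𝕜).domain,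
            L (Γ.rightTrace 𝕜 hΓ ⟨f, hf⟩) = Γ.leftTrace 𝕜 hΓ ⟨f, hf⟩} :=
  (MetricGraph.isBoundarySystem_prod_traces hΓ).isSkewSelfAdjoint_iff_exists_linearIsometryEquiv hH
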